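/- **Theorem 1.3.** Let $(p_i)_{i=1}^{K}$ be a probability vector that is non-uniform in the sense that its nonzero entries are not all equal (if all $p_i$ are positive, this says exactly that $p_i\neq 1/K$ for some $i$). Let $\mu$ be the corresponding Bernoulli measure on the full shift $\Sigma=\{1,\ldots,K\}^{\mathbb{N}}$, that is, the product measure with $\mu(\{\mathbf{j}\in\Sigma : j_1=i_1,\ldots,j_n=i_n\})=p_{i_1}\cdots p_{i_n}$ for all words $i_1\ldots i_n$. Let $\sigma$ be the left shift on $\Sigma$, and equip $\Sigma$ with the metric $d(\mathbf{i},\mathbf{j})=K^{-|\mathbf{i}\wedge\mathbf{j}|}$, where $|\mathbf{i}\wedge\mathbf{j}|=\inf\{n\ge 0: i_{n+1}\neq j_{n+1}\}$ (so $d(\mathbf{i},\mathbf{i})=0$). For $\Psi:\mathbb{N}\to[0,\infty)$ put $$R(\Psi)=\{\mathbf{i}\in\Sigma : d(\sigma^n\mathbf{i},\mathbf{i})\le\Psi(n)\text{ for infinitely many }n\in\mathbb{N}\}.$$ Let $$h=-\sum_{i=1}^K p_i\log p_i,\qquad \rho=\sum_{i=1}^K p_i(\log p_i)^2-\Big(\sum_{i=1}^K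 p_i\log p_i\Big)^2$$ (with $0\log 0=0(\log 0)^2=0$) be the entropy and the variance of $\mu$. Then $h>0$ and $\rho>0$. For $\varepsilon>0$ and $n\in\mathbb{N}$ let $$\psi^{\pm}_{\varepsilon}(n)=\left\lfloor \frac{\log n}{h}+\frac{1\pm\varepsilon}{h^{3/2}}\sqrt{2\rho\log n\,\log\log\log n}\right\rfloor,\qquad \Psi^{\pm}_{\varepsilon}(n)=K^{-\psi^{\pm}_{\varepsilon}(n)},$$ where, in the formula for $\psi^{\pm}_\varepsilon$, $\log x$ is read as $0$ whenever $x\le 1$. Then for every $\varepsilon>0$, $$\mu(R(\Psi^{+}_{\varepsilon}))=0\qquad\text{and}\qquad\mu(R(\Psi^{-}_{\varepsilon}))=1.$$ -/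

import Mathlib

open Filter MeasureTheory

namespace BernoulliRecurrence

noncomputable section

/-- The full shift on `K` symbols. Symbols and coordinates are numbered from `0`, so that the
coordinate `x n` is the `(n + 1)`-st letter of the sequence `x`. -/
abbrev FullShift (K : ℕ) : Type := ℕ → Fin K

/-- The left shift `σ (x₀, x₁, x₂, …) = (x₁, x₂, …)`. -/
def leftShift {K : ℕ} (x : FullShift K) : FullShift K := fun n => x (n + 1)

open Classical in
/-- The metric `d x y = K ^ (-|x ∧ y|)`, where `|x ∧ y|` is the length of the longest common prefix
of `x` and `y`. For `x ≠ y` this length is the first index at which `x` and `y` differ; for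
`x = y` it is infinite and the distance is `0`. -/
def shiftDist {K : ℕ} (x y : FullShift K) : ℝ :=
  if x = y then 0 else (K : ℝ) ^ (-(PiNat.firstDiff x y : ℤ))

/-- The measure on the set of symbols that gives mass `p i` to the symbol `i`. -/
def symbolMeasure {K : ℕ} (p : Fin K → ℝ) : Measure (Fin K) :=
  ∑ i, ENNReal.ofReal (p i) • Measure.dirac i

/-- The Bernoulli measure of a probability vector `p` on the full shift: the product measure
under which the coordinates are independent and have distribution `p`. -/
def bernoulliMeasure {K : ℕ} (p : Fin K → ℝ) : Measure (FullShift K) :=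
  Measure.infinitePi fun _ : ℕ => symbolMeasure p

/-- The entropy `-∑ pᵢ log pᵢ` of a Bernoulli measure (with `0 log 0 = 0`). -/
def entropy {K : ℕ} (p : Fin K → ℝ) : ℝ :=
  -∑ i, p i * Real.log (p i)

/-- The variance `∑ pᵢ (log pᵢ)² - (∑ pᵢ log pᵢ)²` of a Bernoulli measure
(with `0 log 0 = 0`). -/
def variance {K : ℕ} (p : Fin K → ℝ) : ℝ :=
  ∑ i, p i * Real.log (p i) ^ 2 - (∑ i, p i * Real.log (p i)) ^ 2

/-- The recurrence set of a map `T` with respect to a distance function `d` and a rate `Ψ`: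
the points `x` such that `d (T^n x) x ≤ Ψ n` for infinitely many `n`. -/
def recurrenceSet {X : Type*} (d : X → X → ℝ) (T : X → X) (Ψ : ℕ → ℝ) : Set X :=
  {x | ∃ᶠ n : ℕ in atTop, d (T^[n] x) x ≤ Ψ n}

/-- `⌊ log n / h + c * h ^ (-3/2) * √(2 ρ log n log log log n) ⌋`, with the convention that
`log x = 0` for `x ≤ 1`. All logarithms here are taken at nonnegative arguments, where
`Real.posLog x = max 0 (log x)` is the logarithm with that convention. -/
def returnLength (h ρ c : ℝ) (n : ℕ) : ℤ :=
  ⌊Real.posLog n / h +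
    c / h ^ (3 / 2 : ℝ) *
      √(2 * ρ * Real.posLog n * Real.posLog (Real.posLog (Real.posLog n)))⌋

/-- The rate `Ψ n = K ^ (-ψ n)` that belongs to `ψ = returnLength h ρ c`. -/
def returnRate (K : ℕ) (h ρ c : ℝ) (n : ℕ) : ℝ :=
  (K : ℝ) ^ (-returnLength h ρ c n)

end

end BernoulliRecurrence

/-!
Let `X i x = h + log (p (x i))`, with `h` the entropy. These are independent, centred and of variance
`ρ` under the Bernoulli measure `μ`, and the partial sum `T m` of the first `m` of them satisfies
`μ (cylinder of the first m letters of x) = exp (T m x - h m)` for almost every `x`. The probability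
that `x` sees its own initial word of length `m` again at a time `n ≥ m` is therefore governed by
`T m x`, whose fluctuations are described by the law of the iterated logarithm with the scale
`φ m = √(2 ρ m log log m)`. Since `m ~ log n / h` for the lengths in question, `φ m` is asymptotic to
`√(2 ρ log n log log log n) / √h`.

* For the constant `1 + ε`, almost every `x` has `T m x ≤ (1 + δ) φ m` for all large `m`
  (`ae_eventually_sum_le`). With `m = returnLength h ρ (1 + ε) n` such words have probability at most
  `1 / (n (log n)²)` (`eventually_lilScale_sub_le`), so that the first Borel-Cantelli lemma forbids
  infinitely many returns (`ae_notMem_recurrenceSet`).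
* For the constant `1 - ε`, choose `1 - ε < c < b < 1`. Almost every `x` has `T m x ≥ b φ m` for
  infinitely many `m` (`ae_frequently_le_sum`). Such a word is independently tested at the times
  `m, 2 m, …` up to `exp (h m - c φ m)`, and the probability that all the tests fail is summable over
  `m` (`measureReal_le_sum_inter_no_return_le`). Hence one of them succeeds for infinitely many `m`,
  at a time `n` with `returnLength h ρ (1 - ε) n ≤ m` (`ae_mem_recurrenceSet`).

The law of the iterated logarithm is proved for independent variables whose moment generating
functions are `exp (ρ t² / 2)` to leading order near `0`. The upper half uses Doob's maximal inequality
along a geometric sequence. The lower half uses a lower bound for moderate deviations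
(`le_measure_sum_ge`), which follows by comparing the moment generating function at three
neighbouring points, the second Borel-Cantelli lemma for the increments along a geometric sequence,
and the upper half for `-X`.
-/

namespace BernoulliRecurrence

open ProbabilityTheory Topology

section IteratedLogarithm

variable {Ω : Type*} {mΩ : MeasurableSpace Ω} {μ : Measure Ω} {X : ℕ → Ω → ℝ} {ρ : ℝ}

/-! ### Moderate deviations for independent sums -/

/-- The moment generating functions of the `X i` are `exp (ρ t² / 2)` to leading order as `t → 0`,
uniformly in `i`. This is the only information on the distributions that the law of the iterated
logarithm needs, and it is inherited by `-X`. -/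
def HasGaussianMGFNearZero (X : ℕ → Ω → ℝ) (ρ : ℝ) (μ : Measure Ω) : Prop :=
  ∀ η : ℝ, 0 < η → ∃ t₀ : ℝ, 0 < t₀ ∧ ∀ t : ℝ, |t| ≤ t₀ → ∀ i,
    Integrable (fun ω => Real.exp (t * X i ω)) μ ∧
      Real.exp ((1 - η) * (ρ * t ^ 2 / 2)) ≤ mgf (X i) μ t ∧
      mgf (X i) μ t ≤ Real.exp ((1 + η) * (ρ * t ^ 2 / 2))

lemma HasGaussianMGFNearZero.neg (h : HasGaussianMGFNearZero X ρ μ) :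
    HasGaussianMGFNearZero (fun i ω => -X i ω) ρ μ := by
  intro η hη
  obtain ⟨t₀, ht₀, H⟩ := h η hη
  refine ⟨t₀, ht₀, fun t ht i => ?_⟩
  obtain ⟨h1, h2, h3⟩ := H (-t) (by simpa using ht) i
  have e : mgf (fun ω => -X i ω) μ t = mgf (X i) μ (-t) := by
    simp [mgf]
  rw [e]
  refine ⟨by simpa using h1, by simpa using h2, by simpa using h3⟩

lemma HasGaussianMGFNearZero.sum (h : HasGaussianMGFNearZero X ρ μ) (hX : iIndepFun X μ)
    (hm : ∀ i, Measurable (X i)) {η : ℝ} (hη : 0 < η) :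
    ∃ t₀ : ℝ, 0 < t₀ ∧ ∀ t : ℝ, |t| ≤ t₀ → ∀ F : Finset ℕ,
      Integrable (fun ω => Real.exp (t * ∑ i ∈ F, X i ω)) μ ∧
      Real.exp ((1 - η) * (F.card * ρ * t ^ 2 / 2)) ≤ ∫ ω, Real.exp (t * ∑ i ∈ F, X i ω) ∂μ ∧
      ∫ ω, Real.exp (t * ∑ i ∈ F, X i ω) ∂μ ≤ Real.exp ((1 + η) * (F.card * ρ * t ^ 2 / 2)) := by
  obtain ⟨t₀, ht₀, H⟩ := h η hη
  have := hX.isProbabilityMeasure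
  refine ⟨t₀, ht₀, fun t ht F => ?_⟩
  have e : ∫ ω, Real.exp (t * ∑ i ∈ F, X i ω) ∂μ = ∏ i ∈ F, mgf (X i) μ t := by
    rw [← hX.mgf_sum hm]
    simp [mgf, Finset.sum_apply]
  rw [e]
  refine ⟨?_, ?_, ?_⟩
  · have := hX.integrable_exp_mul_sum (t := t) hm (s := F) (fun i _ => (H t ht i).1)
    simpa [Finset.sum_apply] using this
  · calc _ = ∏ i ∈ F, Real.exp ((1 - η) * (ρ * t ^ 2 / 2)) := by
          rw [Finset.prod_const, ← Real.exp_nat_mul]; congr 1; ring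
      _ ≤ _ := Finset.prod_le_prod (fun _ _ => (Real.exp_pos _).le) fun i _ => (H t ht i).2.1
  · calc _ ≤ ∏ i ∈ F, Real.exp ((1 + η) * (ρ * t ^ 2 / 2)) :=
          Finset.prod_le_prod (fun _ _ => mgf_nonneg) fun i _ => (H t ht i).2.2
      _ = _ := by
          rw [Finset.prod_const, ← Real.exp_nat_mul]; congr 1; ring

/-- Doob's maximal inequality for `exp (t * Tₖ)`, where `Tₖ` are the partial sums; the process is a
submartingale as soon as the single moment generating functions are at least `1`. -/
lemma measure_exists_le_sum_le (hX : iIndepFun X μ) (hm : ∀ i, Measurable (X i)) {t : ℝ}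
    (ht : 0 ≤ t) (hint : ∀ n, Integrable (fun ω => Real.exp (t * ∑ i ∈ Finset.range n, X i ω)) μ)
    (hint1 : ∀ n, Integrable (fun ω => Real.exp (t * X n ω)) μ)
    (h1 : ∀ i, 1 ≤ mgf (X i) μ t) (n : ℕ) {a : ℝ} (ha : 0 < a) :
    μ.real {ω | ∃ k ≤ n, a ≤ ∑ i ∈ Finset.range k, X i ω} ≤
      Real.exp (-(t * a)) * ∫ ω, Real.exp (t * ∑ i ∈ Finset.range n, X i ω) ∂μ := by
  have := hX.isProbabilityMeasure
  have hsm : ∀ i, StronglyMeasurable (X i) := fun i => (hm i).stronglyMeasurable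
  have hnn : 0 ≤ Real.exp (-(t * a)) * ∫ ω, Real.exp (t * ∑ i ∈ Finset.range n, X i ω) ∂μ :=
    mul_nonneg (Real.exp_pos _).le (integral_nonneg fun _ => (Real.exp_pos _).le)
  obtain _ | n := n
  · have : {ω | ∃ k ≤ 0, a ≤ ∑ i ∈ Finset.range k, X i ω} = (∅ : Set Ω) := by
      ext ω
      simp only [Set.mem_ofPred_eq, Set.mem_empty_iff_false, iff_false]
      rintro ⟨k, hk, h⟩
      obtain rfl : k = 0 := by omega
      simp at h
      linarith
    rw [this]
    simpa using hnn
  -- The sum of the first `k + 1` terms is known at time `k` of the natural filtration.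
  let M : ℕ → Ω → ℝ := fun k ω => Real.exp (t * ∑ i ∈ Finset.range (k + 1), X i ω)
  have hadp : StronglyAdapted (Filtration.natural X hsm) M := by
    intro k
    have hS : StronglyMeasurable[Filtration.natural X hsm k]
        (fun ω => ∑ i ∈ Finset.range (k + 1), X i ω) := by
      refine Finset.stronglyMeasurable_fun_sum _ fun i hi => ?_
      refine (Filtration.stronglyAdapted_natural hsm i).mono
        ((Filtration.natural X hsm).mono ?_)
      have := Finset.mem_range.1 hi
      omega
    exact Real.continuous_exp.comp_stronglyMeasurable (hS.const_mul t)
  have hsub : Submartingale M (Filtration.natural X hsm) μ := by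
    refine submartingale_nat hadp (fun k => hint (k + 1)) fun k => ?_
    have e : M (k + 1) = M k * fun ω => Real.exp (t * X (k + 1) ω) := by
      ext ω
      simp only [M, Pi.mul_apply]
      rw [Finset.sum_range_succ _ (k + 1), mul_add, Real.exp_add]
    have hc : μ[fun ω => Real.exp (t * X (k + 1) ω) | Filtration.natural X hsm k]
        =ᵐ[μ] fun _ => mgf (X (k + 1)) μ t :=
      condExp_indep_eq (hsm (k + 1)).measurable.comap_le (Filtration.le _ _)
        (Real.continuous_exp.comp_stronglyMeasurable
          ((comap_measurable (X (k + 1))).stronglyMeasurable.const_mul t))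
        (hX.indep_comap_natural_of_lt hsm (Nat.lt_succ_self k))
    have hmul := condExp_mul_of_stronglyMeasurable_left (μ := μ) (hadp k)
      (by rw [← e]; exact hint (k + 2)) (hint1 (k + 1))
    rw [e]
    filter_upwards [hmul, hc] with ω h2 h3
    rw [h2, Pi.mul_apply, h3]
    exact le_mul_of_one_le_right (Real.exp_pos _).le (h1 _)
  have hmax := maximal_ineq hsub (fun k ω => (Real.exp_pos _).le)
    (ε := ⟨Real.exp (t * a), (Real.exp_pos _).le⟩) n
  set S : Set Ω := {ω | ((⟨Real.exp (t * a), (Real.exp_pos _).le⟩ : NNReal) : ℝ) ≤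
    (Finset.range (n + 1)).sup' Finset.nonempty_range_add_one fun k => M k ω} with hS
  have hsubset : {ω | ∃ k ≤ n + 1, a ≤ ∑ i ∈ Finset.range k, X i ω} ⊆ S := by
    rintro ω ⟨k, hk, h⟩
    obtain _ | k := k
    · simp at h
      linarith
    · rw [hS, Set.mem_ofPred_eq, Finset.le_sup'_iff]
      refine ⟨k, Finset.mem_range.2 (by omega), ?_⟩
      exact Real.exp_le_exp.2 (mul_le_mul_of_nonneg_left h ht)
  have h2 : Real.exp (t * a) * μ.real S ≤ ∫ ω, M n ω ∂μ := by
    have h3 := ENNReal.toReal_mono ENNReal.ofReal_ne_top hmax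
    rw [ENNReal.toReal_mul, ENNReal.toReal_ofReal
      (integral_nonneg fun _ => (Real.exp_pos _).le)] at h3
    exact h3.trans (setIntegral_le_integral (hint (n + 1))
      (ae_of_all _ fun _ => (Real.exp_pos _).le))
  calc _ ≤ μ.real S := measureReal_mono hsubset
    _ = Real.exp (-(t * a)) * (Real.exp (t * a) * μ.real S) := by
      rw [← mul_assoc, ← Real.exp_add]; simp
    _ ≤ _ := by gcongr

/-- If `exp (t * T)` carries little mass outside `{a ≤ T ≤ b}`, as measured by the moment generating
function at the neighbouring points `t * (1 ± δ)`, then `{a ≤ T}` cannot be too small. -/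
lemma integral_exp_mul_le [IsProbabilityMeasure μ] {T : Ω → ℝ} (hT : Measurable T) {t δ : ℝ}
    (ht : 0 < t) (hδ : 0 < δ) (a b : ℝ) (h0 : Integrable (fun ω => Real.exp (t * T ω)) μ)
    (h1 : Integrable (fun ω => Real.exp (t * (1 + δ) * T ω)) μ)
    (h2 : Integrable (fun ω => Real.exp (t * (1 - δ) * T ω)) μ) :
    ∫ ω, Real.exp (t * T ω) ∂μ ≤ μ.real {ω | a ≤ T ω} * Real.exp (t * b) +
      (Real.exp (-(t * δ * b)) * ∫ ω, Real.exp (t * (1 + δ) * T ω) ∂μ +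
        Real.exp (t * δ * a) * ∫ ω, Real.exp (t * (1 - δ) * T ω) ∂μ) := by
  have hSm : MeasurableSet {ω | a ≤ T ω} := measurableSet_le measurable_const hT
  have i1 : Integrable ({ω | a ≤ T ω}.indicator (fun _ => Real.exp (t * b))) μ :=
    (integrable_const _).indicator hSm
  have i2 := h1.const_mul (Real.exp (-(t * δ * b)))
  have i3 := h2.const_mul (Real.exp (t * δ * a))
  have i23 : Integrable (fun ω => Real.exp (-(t * δ * b)) * Real.exp (t * (1 + δ) * T ω) +
    Real.exp (t * δ * a) * Real.exp (t * (1 - δ) * T ω)) μ := i2.add i3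
  have i123 : Integrable (fun ω => {ω | a ≤ T ω}.indicator (fun _ => Real.exp (t * b)) ω +
    (Real.exp (-(t * δ * b)) * Real.exp (t * (1 + δ) * T ω) +
    Real.exp (t * δ * a) * Real.exp (t * (1 - δ) * T ω))) μ := i1.add i23
  calc ∫ ω, Real.exp (t * T ω) ∂μ ≤
      ∫ ω, ({ω | a ≤ T ω}.indicator (fun _ => Real.exp (t * b)) ω +
      (Real.exp (-(t * δ * b)) * Real.exp (t * (1 + δ) * T ω) +
       Real.exp (t * δ * a) * Real.exp (t * (1 - δ) * T ω))) ∂μ := by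
        refine integral_mono h0 i123 fun ω => ?_
        dsimp only
        rw [← Real.exp_add, ← Real.exp_add]
        have p1 := Real.exp_pos (-(t * δ * b) + t * (1 + δ) * T ω)
        have p2 := Real.exp_pos (t * δ * a + t * (1 - δ) * T ω)
        have htd : 0 < t * δ := by positivity
        by_cases h1 : a ≤ T ω
        · rw [Set.indicator_of_mem (show ω ∈ {ω | a ≤ T ω} from h1)]
          by_cases h2 : T ω ≤ b
          · have : Real.exp (t * T ω) ≤ Real.exp (t * b) := Real.exp_le_exp.2 (by gcongr)
            linarith
          · have : Real.exp (t * T ω) ≤ Real.exp (-(t * δ * b) + t * (1 + δ) * T ω) :=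
              Real.exp_le_exp.2 (by nlinarith)
            linarith [Real.exp_pos (t * b)]
        · rw [Set.indicator_of_notMem (show ω ∉ {ω | a ≤ T ω} from h1)]
          have : Real.exp (t * T ω) ≤ Real.exp (t * δ * a + t * (1 - δ) * T ω) :=
              Real.exp_le_exp.2 (by nlinarith)
          linarith
    _ = _ := by
      rw [integral_add i1 i23, integral_add i2 i3, integral_const_mul, integral_const_mul,
        integral_indicator_const _ hSm, smul_eq_mul]

/-- Cramér's lower bound in the moderate deviation regime. -/
lemma le_measure_sum_ge (h : HasGaussianMGFNearZero X ρ μ) (hX : iIndepFun X μ)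
    (hm : ∀ i, Measurable (X i)) (hρ : 0 < ρ) {δ : ℝ} (hδ : 0 < δ) (hδ1 : δ < 1) :
    ∃ t₀ : ℝ, 0 < t₀ ∧ ∃ C : ℝ, ∀ t : ℝ, 0 < t → t ≤ t₀ → ∀ F : Finset ℕ,
      C ≤ F.card * ρ * t ^ 2 →
      1 / 2 * Real.exp (-((1 + 3 * δ) * (F.card * ρ * t ^ 2 / 2))) ≤
        μ.real {ω | (1 - δ) * (F.card * ρ * t) ≤ ∑ i ∈ F, X i ω} := by
  have hP := hX.isProbabilityMeasure
  obtain ⟨t₀, ht₀, H⟩ := h.sum hX hm (η := δ ^ 2 / 10) (by positivity)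
  refine ⟨t₀ / 2, by positivity, 8 / δ ^ 2, fun t ht htt F hC => ?_⟩
  have H0 := H t (by rw [abs_of_pos ht]; linarith) F
  have H1 := H (t * (1 + δ)) (by rw [abs_of_pos (by positivity)]; nlinarith) F
  have H2 := H (t * (1 - δ)) (by
    rw [abs_of_nonneg (mul_nonneg ht.le (by linarith))]; nlinarith) F
  have hI := integral_exp_mul_le (μ := μ) (Finset.measurable_fun_sum F fun i _ => hm i) ht hδ
    ((1 - δ) * (F.card * ρ * t)) ((1 + δ) * (F.card * ρ * t)) H0.1 H1.1 H2.1
  have e2 : F.card * ρ * (t * (1 + δ)) ^ 2 / 2 = (1 + δ) ^ 2 * (F.card * ρ * t ^ 2 / 2) := by ring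
  have e3 : F.card * ρ * (t * (1 - δ)) ^ 2 / 2 = (1 - δ) ^ 2 * (F.card * ρ * t ^ 2 / 2) := by ring
  rw [e2] at H1
  rw [e3] at H2
  have e4 : t * δ * ((1 + δ) * (F.card * ρ * t)) = δ * (1 + δ) * (F.card * ρ * t ^ 2) := by ring
  have e5 : t * δ * ((1 - δ) * (F.card * ρ * t)) = δ * (1 - δ) * (F.card * ρ * t ^ 2) := by ring
  have e6 : t * ((1 + δ) * (F.card * ρ * t)) = (1 + δ) * (F.card * ρ * t ^ 2) := by ring
  rw [e4, e5, e6] at hI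
  have hA0 : 0 ≤ F.card * ρ * t ^ 2 := by positivity
  replace H0 := H0.2.1
  replace H1 := H1.2.2
  replace H2 := H2.2.2
  clear H e2 e3 e4 e5 e6 h
  generalize (F.card * ρ * t ^ 2 : ℝ) = A at *
  generalize ∫ ω, Real.exp (t * (1 + δ) * ∑ i ∈ F, X i ω) ∂μ = I1 at *
  generalize ∫ ω, Real.exp (t * (1 - δ) * ∑ i ∈ F, X i ω) ∂μ = I2 at *
  generalize ∫ ω, Real.exp (t * ∑ i ∈ F, X i ω) ∂μ = I0 at *
  generalize μ.real {ω | (1 - δ) * (F.card * ρ * t) ≤ ∑ i ∈ F, X i ω} = P at *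
  have hE0 : 0 < Real.exp ((1 - δ ^ 2 / 10) * (A / 2)) := Real.exp_pos _
  have q : Real.exp (-(δ ^ 2 * A / 4)) ≤ 1 / 4 := by
    have : 2 ≤ δ ^ 2 * A / 4 := by
      rw [div_le_iff₀ (by positivity)] at hC
      linarith
    have h2 : (2:ℝ) ≤ Real.exp 1 := by linarith [Real.add_one_le_exp (1:ℝ)]
    have h4 : (4:ℝ) ≤ Real.exp 2 := by
      rw [show (2:ℝ) = 1 + 1 by norm_num, Real.exp_add]; nlinarith
    rw [Real.exp_neg]
    have : (4:ℝ) ≤ Real.exp (δ ^ 2 * A / 4) := h4.trans (Real.exp_le_exp.2 this)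
    rw [inv_le_comm₀ (by positivity) (by norm_num)]
    simpa using this
  have t1 : Real.exp (-(δ * (1 + δ) * A)) * I1 ≤
      Real.exp ((1 - δ ^ 2 / 10) * (A / 2)) * (1 / 4) := by
    calc _ ≤ Real.exp (-(δ * (1 + δ) * A)) *
        Real.exp ((1 + δ ^ 2 / 10) * ((1 + δ) ^ 2 * (A / 2))) := by gcongr
      _ ≤ Real.exp ((1 - δ ^ 2 / 10) * (A / 2)) * Real.exp (-(δ ^ 2 * A / 4)) := by
          rw [← Real.exp_add, ← Real.exp_add, Real.exp_le_exp]
          have : 0 ≤ A * δ ^ 2 * ((1 - δ) * (3 + δ)) :=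
            mul_nonneg (by positivity) (mul_nonneg (by linarith) (by linarith))
          linarith
      _ ≤ _ := by gcongr
  have t2 : Real.exp (δ * (1 - δ) * A) * I2 ≤
      Real.exp ((1 - δ ^ 2 / 10) * (A / 2)) * (1 / 4) := by
    calc _ ≤ Real.exp (δ * (1 - δ) * A) *
        Real.exp ((1 + δ ^ 2 / 10) * ((1 - δ) ^ 2 * (A / 2))) := by gcongr
      _ ≤ Real.exp ((1 - δ ^ 2 / 10) * (A / 2)) * Real.exp (-(δ ^ 2 * A / 4)) := by
          rw [← Real.exp_add, ← Real.exp_add, Real.exp_le_exp]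
          have : 0 ≤ A * δ ^ 2 * ((1 + δ) * (3 - δ)) :=
            mul_nonneg (by positivity) (mul_nonneg (by linarith) (by linarith))
          linarith
      _ ≤ _ := by gcongr
  have key : Real.exp ((1 - δ ^ 2 / 10) * (A / 2)) / 2 ≤ P * Real.exp ((1 + δ) * A) := by linarith
  calc _ ≤ 1 / 2 * (Real.exp ((1 - δ ^ 2 / 10) * (A / 2)) * Real.exp (-((1 + δ) * A))) := by
        rw [← Real.exp_add]
        gcongr
        have : 0 ≤ A * δ * (1 - δ / 10) := mul_nonneg (by positivity) (by linarith)
        linarith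
    _ = Real.exp ((1 - δ ^ 2 / 10) * (A / 2)) / 2 * Real.exp (-((1 + δ) * A)) := by ring
    _ ≤ P * Real.exp ((1 + δ) * A) * Real.exp (-((1 + δ) * A)) := by gcongr
    _ = P := by rw [mul_assoc, ← Real.exp_add]; simp

/-! ### The law of the iterated logarithm -/

/-- The normalisation `√(2 ρ x log log x)` of the law of the iterated logarithm for variance `ρ`.
It is only meaningful for `x ≥ e`. -/
noncomputable def lilScale (ρ x : ℝ) : ℝ := √(2 * ρ * x * Real.log (Real.log x))

lemma lilScale_nonneg (ρ x : ℝ) : 0 ≤ lilScale ρ x := Real.sqrt_nonneg _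

lemma one_le_log_of_exp_one_le {x : ℝ} (h : Real.exp 1 ≤ x) : 1 ≤ Real.log x := by
  rwa [Real.le_log_iff_exp_le ((Real.exp_pos 1).trans_le h)]

lemma log_log_nonneg {x : ℝ} (h : Real.exp 1 ≤ x) : 0 ≤ Real.log (Real.log x) :=
  Real.log_nonneg (one_le_log_of_exp_one_le h)

lemma log_log_le_log_log {x y : ℝ} (hx : Real.exp 1 ≤ x) (hxy : x ≤ y) :
    Real.log (Real.log x) ≤ Real.log (Real.log y) := by
  have h0 : 0 < x := (Real.exp_pos 1).trans_le hx
  have h1 := one_le_log_of_exp_one_le hx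
  gcongr

lemma lilScale_le_lilScale (hρ : 0 ≤ ρ) {x y : ℝ} (hx : Real.exp 1 ≤ x) (hxy : x ≤ y) :
    lilScale ρ x ≤ lilScale ρ y := by
  have h0 : 0 < x := (Real.exp_pos 1).trans_le hx
  have h1 := log_log_nonneg hx
  have h2 := log_log_le_log_log hx hxy
  have h3 : 0 ≤ y := h0.le.trans hxy
  refine Real.sqrt_le_sqrt ?_
  gcongr

lemma lilScale_sq (hρ : 0 ≤ ρ) {x : ℝ} (hx : Real.exp 1 ≤ x) :
    lilScale ρ x ^ 2 = 2 * ρ * x * Real.log (Real.log x) := by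
  have h0 : 0 < x := (Real.exp_pos 1).trans_le hx
  have h1 := log_log_nonneg hx
  exact Real.sq_sqrt (by positivity)

lemma tendsto_log_log_atTop : Tendsto (fun x => Real.log (Real.log x)) atTop atTop :=
  Real.tendsto_log_atTop.comp Real.tendsto_log_atTop

lemma tendsto_lilScale_div_atTop (ρ : ℝ) : Tendsto (fun x => lilScale ρ x / x) atTop (𝓝 0) := by
  have h1 : Tendsto (fun x : ℝ => Real.log x / x) atTop (𝓝 0) :=
    Real.isLittleO_log_id_atTop.tendsto_div_nhds_zero
  have h2 : Tendsto (fun x : ℝ => Real.log (Real.log x) / Real.log x) atTop (𝓝 0) :=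
    h1.comp Real.tendsto_log_atTop
  have h3 : Tendsto (fun x : ℝ => √(2 * ρ * (Real.log (Real.log x) / Real.log x *
      (Real.log x / x)))) atTop (𝓝 0) := by
    have := ((h2.mul h1).const_mul (2 * ρ)).sqrt
    simpa using this
  refine h3.congr' ?_
  filter_upwards [eventually_ge_atTop (Real.exp 1)] with x hx
  have h0 : 0 < x := (Real.exp_pos 1).trans_le hx
  have hl : Real.log x ≠ 0 := by linarith [one_le_log_of_exp_one_le hx]
  calc _ = √(2 * ρ * x * Real.log (Real.log x) / x ^ 2) := by
        congr 1
        field_simp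
    _ = _ := by rw [Real.sqrt_div' _ (sq_nonneg x), Real.sqrt_sq h0.le, lilScale]

lemma ae_eventually_notMem_of_summable [IsFiniteMeasure μ] {s : ℕ → Set Ω} {u : ℕ → ℝ}
    (hu : Summable u) (h : ∀ᶠ k in atTop, μ.real (s k) ≤ u k) :
    ∀ᵐ ω ∂μ, ∀ᶠ k in atTop, ω ∉ s k := by
  have hs : Summable fun k => μ.real (s k) := by
    refine Summable.of_norm_bounded_eventually_nat hu ?_
    filter_upwards [h] with k hk
    rwa [Real.norm_of_nonneg measureReal_nonneg]
  refine ae_eventually_notMem ?_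
  have := hs.tsum_ofReal_ne_top
  simpa [ofReal_measureReal] using this

/-- The upper half of the law of the iterated logarithm. -/
theorem ae_eventually_sum_le (h : HasGaussianMGFNearZero X ρ μ) (hX : iIndepFun X μ)
    (hm : ∀ i, Measurable (X i)) (hρ : 0 < ρ) {δ : ℝ} (hδ : 0 < δ) :
    ∀ᵐ ω ∂μ, ∀ᶠ n : ℕ in atTop, ∑ i ∈ Finset.range n, X i ω ≤ (1 + δ) * lilScale ρ n := by
  have hP := hX.isProbabilityMeasure
  have hη : 0 < δ / (2 * (1 + δ)) := by positivity
  have hη1 : δ / (2 * (1 + δ)) ≤ 1 := by rw [div_le_one (by positivity)]; linarith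
  obtain ⟨t₁, ht₁, H1⟩ := h _ hη
  obtain ⟨t₂, ht₂, H2⟩ := h.sum hX hm hη
  have hθ : 1 < 1 + δ := by linarith
  have hlog : 0 < Real.log (1 + δ) := Real.log_pos hθ
  have hpow : Tendsto (fun k : ℕ => (1 + δ) ^ k) atTop atTop := tendsto_pow_atTop_atTop_of_one_lt hθ
  -- The blocks are `(1 + δ) ^ k ≤ n < (1 + δ) ^ (k + 1)`; on each of them `lilScale` is bounded
  -- below by its value at the left end.
  have hsum : Summable fun k : ℕ =>
      (Real.log (1 + δ)) ^ (-(1 + δ / 2)) * (k : ℝ) ^ (-(1 + δ / 2)) :=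
    (Real.summable_nat_rpow.2 (by linarith)).mul_left _
  have hbound : ∀ᶠ k : ℕ in atTop,
      μ.real {ω | ∃ j ≤ ⌊(1 + δ) ^ (k + 1)⌋₊,
        (1 + δ) * lilScale ρ ((1 + δ) ^ k) ≤ ∑ i ∈ Finset.range j, X i ω} ≤
      (Real.log (1 + δ)) ^ (-(1 + δ / 2)) * (k : ℝ) ^ (-(1 + δ / 2)) := by
    have hsmall := ((tendsto_lilScale_div_atTop ρ).const_mul (1 / ρ)).comp hpow
    rw [mul_zero] at hsmall
    filter_upwards [hsmall.eventually (eventually_le_nhds (lt_min ht₁ ht₂)),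
      hpow.eventually_gt_atTop (Real.exp 1), eventually_gt_atTop 0] with k hk hke hk0
    have hx0 : (0 : ℝ) < (1 + δ) ^ k := by positivity
    have hL : 0 < Real.log (Real.log ((1 + δ) ^ k)) := by
      refine Real.log_pos ?_
      rwa [Real.lt_log_iff_exp_lt hx0]
    have hsq := lilScale_sq hρ.le hke.le
    have hφ : 0 < lilScale ρ ((1 + δ) ^ k) := Real.sqrt_pos.2 (by positivity)
    have hlogx : Real.log ((1 + δ) ^ k) = k * Real.log (1 + δ) := by rw [Real.log_pow]
    set x : ℝ := (1 + δ) ^ k with hx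
    set t : ℝ := 1 / ρ * (lilScale ρ x / x) with ht
    have ht0 : 0 ≤ t := by positivity
    have htmin : t ≤ min t₁ t₂ := hk
    have a1 : |t| ≤ t₁ := by rw [abs_of_nonneg ht0]; exact htmin.trans (min_le_left _ _)
    have a2 : |t| ≤ t₂ := by rw [abs_of_nonneg ht0]; exact htmin.trans (min_le_right _ _)
    have hmax := measure_exists_le_sum_le hX hm ht0 (fun n => (H2 t a2 _).1)
      (fun n => (H1 t a1 n).1) (fun i => le_trans (Real.one_le_exp
        (mul_nonneg (by linarith) (by positivity))) (H1 t a1 i).2.1) ⌊(1 + δ) ^ (k + 1)⌋₊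
      (a := (1 + δ) * lilScale ρ x) (by positivity)
    refine hmax.trans ?_
    calc _ ≤ Real.exp (-(t * ((1 + δ) * lilScale ρ x))) *
          Real.exp ((1 + δ / (2 * (1 + δ))) * (((1 + δ) * x) * ρ * t ^ 2 / 2)) := by
          gcongr
          refine (H2 t a2 _).2.2.trans ?_
          gcongr
          rw [Finset.card_range]
          refine (Nat.floor_le (by positivity)).trans (le_of_eq ?_)
          rw [hx]; ring
      _ = Real.exp (Real.log (Real.log x) * (-(1 + δ / 2))) := by
          rw [← Real.exp_add]
          congr 1
          have e1 : t * ((1 + δ) * lilScale ρ x) = (1 + δ) * (1 / (ρ * x)) * lilScale ρ x ^ 2 := by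
            rw [ht]; field_simp
          have e2 : ((1 + δ) * x) * ρ * t ^ 2 / 2 =
              (1 + δ) / 2 * (1 / (ρ * x)) * lilScale ρ x ^ 2 := by
            rw [ht]; field_simp
          rw [e1, e2, hsq]
          field_simp
          ring
      _ = _ := by
          have hk' : (0:ℝ) < k := by exact_mod_cast hk0
          rw [← Real.rpow_def_of_pos (by rw [hlogx]; positivity), hlogx, mul_comm,
            Real.mul_rpow hlog.le hk'.le]
  filter_upwards [ae_eventually_notMem_of_summable hsum hbound] with ω hω
  obtain ⟨k₀, hk₀⟩ := eventually_atTop.1 (hω.and (hpow.eventually_ge_atTop (Real.exp 1)))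
  filter_upwards [tendsto_natCast_atTop_atTop.eventually_ge_atTop ((1 + δ) ^ k₀)] with n hn
  obtain ⟨k, hk1, hk2⟩ := exists_nat_pow_near ((one_le_pow₀ hθ.le).trans hn) hθ
  have hk : k₀ ≤ k := by
    have := (pow_lt_pow_iff_right₀ hθ).1 (hn.trans_lt hk2)
    omega
  obtain ⟨h1, h2⟩ := hk₀ k hk
  by_contra! hcon
  refine h1 ⟨n, Nat.le_floor hk2.le, le_trans ?_ hcon.le⟩
  have := lilScale_le_lilScale hρ.le h2 hk1
  gcongr

/-- Events that depend on disjoint groups of independent variables are independent. -/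
lemma iIndepSet_of_pairwise_disjoint {β ι : Type*} [MeasurableSpace β] {Y : ℕ → Ω → β}
    (hY : iIndepFun Y μ) (hm : ∀ i, Measurable (Y i)) {F : ι → Set ℕ}
    (hF : Pairwise (Function.onFun Disjoint F)) {s : ι → Set Ω}
    (hs : ∀ k, MeasurableSet[⨆ i ∈ F k, MeasurableSpace.comap (Y i) inferInstance] (s k)) :
    iIndepSet s μ := by
  classical
  have hle : ∀ i, MeasurableSpace.comap (Y i) inferInstance ≤ mΩ := fun i => (hm i).comap_le
  have hP := hY.isProbabilityMeasure
  have hs' : ∀ k, MeasurableSet (s k) := fun k => iSup₂_le (fun i _ => hle i) _ (hs k)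
  rw [iIndepSet_iff_meas_biInter hs']
  intro t
  induction t using Finset.induction_on with
  | empty => simp
  | insert a t ha ih =>
    rw [Finset.set_biInter_insert, Finset.prod_insert ha, ← ih]
    have hd : Disjoint (F a) (⋃ k ∈ t, F k) := by
      rw [Set.disjoint_iUnion₂_right]
      intro k hk
      exact hF (fun e => ha (e ▸ hk))
    refine (Indep_iff _ _ μ).1 (indep_iSup_of_disjoint hle hY hd) _ _ (hs a) ?_
    refine MeasurableSet.biInter t.countable_toSet fun k hk => ?_
    refine (iSup₂_le fun i hi => ?_ : (⨆ i ∈ F k, MeasurableSpace.comap (Y i) inferInstance) ≤ _)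
      _ (hs k)
    exact le_iSup₂_of_le i (Set.mem_biUnion hk hi) le_rfl

lemma iIndepSet_sum_Ico_ge (hX : iIndepFun X μ) (hm : ∀ i, Measurable (X i)) {u : ℕ → ℕ}
    (hu : Monotone u) (a : ℕ → ℝ) :
    iIndepSet (fun k => {ω | a k ≤ ∑ i ∈ Finset.Ico (u k) (u (k + 1)), X i ω}) μ := by
  refine iIndepSet_of_pairwise_disjoint hX hm (F := fun k => Set.Ico (u k) (u (k + 1)))
    hu.pairwise_disjoint_on_Ico_succ fun k => ?_
  have : Measurable[⨆ i ∈ Set.Ico (u k) (u (k + 1)), MeasurableSpace.comap (X i) inferInstance]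
      (fun ω => ∑ i ∈ Finset.Ico (u k) (u (k + 1)), X i ω) :=
    Finset.measurable_fun_sum _ fun i hi => (comap_measurable (X i)).mono
      (le_iSup₂_of_le i (Finset.mem_Ico.1 hi) le_rfl) le_rfl
  exact this measurableSet_Ici

lemma lilScale_pow_le (hρ : 0 ≤ ρ) {q : ℕ} (hq : 1 ≤ q) {k : ℕ}
    (h : Real.exp 1 ≤ ((q : ℝ) ^ 2) ^ k) :
    lilScale ρ (((q : ℝ) ^ 2) ^ k) ≤ lilScale ρ (((q : ℝ) ^ 2) ^ (k + 1)) / q := by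
  have hq0 : (1 : ℝ) ≤ q := by exact_mod_cast hq
  have hmono : ((q : ℝ) ^ 2) ^ k ≤ ((q : ℝ) ^ 2) ^ (k + 1) :=
    pow_le_pow_right₀ (one_le_pow₀ hq0) (Nat.le_succ k)
  have h1 := log_log_le_log_log h hmono
  rw [le_div_iff₀ (by positivity)]
  unfold lilScale
  nth_rewrite 3 [← Real.sqrt_sq (by positivity : (0 : ℝ) ≤ q)]
  rw [← Real.sqrt_mul' _ (by positivity)]
  refine Real.sqrt_le_sqrt ?_
  calc _ = 2 * ρ * ((q : ℝ) ^ 2) ^ (k + 1) * Real.log (Real.log (((q : ℝ) ^ 2) ^ k)) := by ring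
    _ ≤ _ := by gcongr

/-- The increments of the partial sums over the blocks `[θ ^ k, θ ^ (k + 1))` are infinitely often
almost as large as the law of the iterated logarithm allows. -/
lemma ae_frequently_le_sum_Ico (h : HasGaussianMGFNearZero X ρ μ) (hX : iIndepFun X μ)
    (hm : ∀ i, Measurable (X i)) (hρ : 0 < ρ) {θ : ℕ} (hθ : 2 ≤ θ) :
    ∀ᵐ ω ∂μ, ∃ᶠ k : ℕ in atTop, (1 - 2 / θ) * lilScale ρ ((θ : ℝ) ^ (k + 1)) ≤
      ∑ i ∈ Finset.Ico (θ ^ k) (θ ^ (k + 1)), X i ω := by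
  have hP := hX.isProbabilityMeasure
  have hθ' : (2 : ℝ) ≤ θ := by exact_mod_cast hθ
  have hθ1 : 1 / (θ : ℝ) ≤ 1 / 2 := by gcongr
  have hθ0 : 0 < 1 / (θ : ℝ) := by positivity
  obtain ⟨t₀, ht₀, C, H⟩ := le_measure_sum_ge h hX hm hρ (δ := 1 / (3 * θ)) (by positivity)
    (by rw [div_lt_one (by positivity)]; linarith)
  have hpow : Tendsto (fun k : ℕ => (θ : ℝ) ^ (k + 1)) atTop atTop :=
    (tendsto_pow_atTop_atTop_of_one_lt (by linarith)).comp (tendsto_add_atTop_nat 1)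
  have hlogθ : 0 < Real.log θ := Real.log_pos (by linarith)
  set s : ℕ → Set Ω := fun k => {ω | (1 - 2 / θ) * lilScale ρ ((θ : ℝ) ^ (k + 1)) ≤
      ∑ i ∈ Finset.Ico (θ ^ k) (θ ^ (k + 1)), X i ω} with hs
  have hsm : ∀ k, MeasurableSet (s k) := fun k =>
    measurableSet_le measurable_const (Finset.measurable_fun_sum _ fun i _ => hm i)
  have hind : iIndepSet s μ := iIndepSet_sum_Ico_ge hX hm
    (u := fun k => θ ^ k) (fun a b hab => Nat.pow_le_pow_right (by omega) hab) _
  have hlow : ∀ᶠ k : ℕ in atTop,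
      1 / ((k : ℝ) + 1) ≤ 2 * Real.log θ * μ.real (s k) := by
    have hsmall := ((tendsto_lilScale_div_atTop ρ).const_mul (1 / ρ)).comp hpow
    rw [mul_zero] at hsmall
    filter_upwards [hsmall.eventually (eventually_le_nhds ht₀),
      hpow.eventually_gt_atTop (Real.exp 1),
      (tendsto_log_log_atTop.comp hpow).eventually_ge_atTop C] with k hk hke hkC
    simp only [Function.comp_apply] at hk hkC
    have hcard : (((Finset.Ico (θ ^ k) (θ ^ (k + 1))).card : ℕ) : ℝ) =
        (1 - 1 / θ) * (θ : ℝ) ^ (k + 1) := by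
      rw [Nat.card_Ico, Nat.cast_sub (Nat.pow_le_pow_right (by omega) (Nat.le_add_right k 1))]
      push_cast
      field_simp
      ring
    have hx0 : (0 : ℝ) < (θ : ℝ) ^ (k + 1) := by positivity
    have hl : 1 < Real.log ((θ : ℝ) ^ (k + 1)) := by rwa [Real.lt_log_iff_exp_lt hx0]
    have hL : 0 < Real.log (Real.log ((θ : ℝ) ^ (k + 1))) := Real.log_pos hl
    have hsq := lilScale_sq hρ.le hke.le
    have hφ : 0 < lilScale ρ ((θ : ℝ) ^ (k + 1)) := Real.sqrt_pos.2 (by positivity)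
    have hlogx : Real.log ((θ : ℝ) ^ (k + 1)) = (k + 1) * Real.log θ := by
      rw [Real.log_pow]; push_cast; ring
    have H' := H _ (by positivity) hk (Finset.Ico (θ ^ k) (θ ^ (k + 1)))
    have hsub : {ω | (1 - 1 / (3 * (θ : ℝ))) * (((Finset.Ico (θ ^ k) (θ ^ (k + 1))).card : ℝ) * ρ *
        (1 / ρ * (lilScale ρ ((θ : ℝ) ^ (k + 1)) / (θ : ℝ) ^ (k + 1)))) ≤
        ∑ i ∈ Finset.Ico (θ ^ k) (θ ^ (k + 1)), X i ω} ⊆ s k := by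
      intro ω hω
      simp only [hs, Set.mem_ofPred_eq] at hω ⊢
      refine le_trans ?_ hω
      rw [hcard]
      have e : (1 - 1 / (θ : ℝ)) * (θ : ℝ) ^ (k + 1) * ρ * (1 / ρ * (lilScale ρ ((θ : ℝ) ^ (k + 1)) /
          (θ : ℝ) ^ (k + 1))) = (1 - 1 / (θ : ℝ)) * lilScale ρ ((θ : ℝ) ^ (k + 1)) := by
        field_simp
      rw [e, ← mul_assoc]
      gcongr
      have e2 : 1 / (3 * (θ : ℝ)) = 1 / θ / 3 := by field_simp
      have e3 : 2 / (θ : ℝ) = 2 * (1 / θ) := by field_simp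
      rw [e2, e3]
      nlinarith
    rw [hcard] at H' hsub
    set x : ℝ := (θ : ℝ) ^ (k + 1) with hx
    have e1 : (1 - 1 / (θ : ℝ)) * x * ρ * (1 / ρ * (lilScale ρ x / x)) ^ 2 =
        (1 - 1 / θ) * (1 / (ρ * x)) * lilScale ρ x ^ 2 := by field_simp
    have e1' : (1 - 1 / (θ : ℝ)) * (1 / (ρ * x)) * (2 * ρ * x * Real.log (Real.log x)) =
        (1 - 1 / θ) * (2 * Real.log (Real.log x)) := by field_simp
    rw [e1, hsq, e1'] at H'
    have hmeas := (H' (by nlinarith)).trans (measureReal_mono hsub)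
    have hexp : 1 / Real.log x ≤ Real.exp (-((1 + 3 * (1 / (3 * (θ : ℝ)))) *
        ((1 - 1 / θ) * (2 * Real.log (Real.log x)) / 2))) := by
      rw [one_div, ← Real.exp_log (inv_pos.2 (by linarith : 0 < Real.log x)), Real.log_inv,
        Real.exp_le_exp]
      have e2 : 3 * (1 / (3 * (θ : ℝ))) = 1 / θ := by field_simp
      rw [e2]
      nlinarith [mul_pos (mul_pos hθ0 hθ0) hL]
    rw [hlogx] at hexp
    have : 1 / ((k : ℝ) + 1) = Real.log θ * (1 / ((k + 1) * Real.log θ)) := by field_simp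
    rw [this]
    have := mul_le_mul_of_nonneg_left hexp hlogθ.le
    have := mul_le_mul_of_nonneg_left hmeas hlogθ.le
    rw [hlogx] at this
    linarith
  have htop : ∑' k, μ (s k) = ⊤ := by
    by_contra hne
    have hsum : Summable fun k => μ.real (s k) := ENNReal.summable_toReal hne
    have h1 : Summable fun k : ℕ => 1 / ((k : ℝ) + 1) := by
      refine Summable.of_norm_bounded_eventually_nat (hsum.mul_left (2 * Real.log θ)) ?_
      filter_upwards [hlow] with k hk
      rwa [Real.norm_of_nonneg (by positivity)]
    refine Real.not_summable_one_div_natCast ((summable_nat_add_iff 1).1 ?_)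
    simpa using h1
  have hone := measure_limsup_eq_one hsm hind htop
  rw [← mem_ae_iff_prob_eq_one (MeasurableSet.measurableSet_limsup hsm)] at hone
  filter_upwards [hone] with ω hω
  exact mem_limsup_iff_frequently_mem.1 hω

/-- The lower half of the law of the iterated logarithm. -/
theorem ae_frequently_le_sum (h : HasGaussianMGFNearZero X ρ μ) (hX : iIndepFun X μ)
    (hm : ∀ i, Measurable (X i)) (hρ : 0 < ρ) {δ : ℝ} (hδ : 0 < δ) :
    ∀ᵐ ω ∂μ, ∃ᶠ n : ℕ in atTop, (1 - δ) * lilScale ρ n ≤ ∑ i ∈ Finset.range n, X i ω := by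
  -- Blocks with ratio `q²`: the sum before a block is at most `2 φ / q`, and the increment over the
  -- block falls short of the scale `φ` by at most `2 φ / q²`.
  obtain ⟨q, hq⟩ := exists_nat_ge (max 2 (4 / δ))
  have hq2 : (2 : ℝ) ≤ q := (le_max_left _ _).trans hq
  have hq2' : 2 ≤ q := by exact_mod_cast hq2
  have hqδ : 4 / (q : ℝ) ≤ δ := by
    rw [div_le_comm₀ (by positivity) hδ]; exact (le_max_right _ _).trans hq
  have hXneg : iIndepFun (fun i ω => -X i ω) μ :=
    hX.comp (fun _ x => -x) fun _ => measurable_neg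
  have hpow : Tendsto (fun k : ℕ => (q ^ 2) ^ k) atTop atTop :=
    tendsto_pow_atTop_atTop_of_one_lt (by nlinarith)
  filter_upwards [ae_frequently_le_sum_Ico h hX hm hρ (θ := q ^ 2) (by nlinarith),
    ae_eventually_sum_le h.neg hXneg (fun i => (hm i).neg) hρ one_pos] with ω h1 h2
  refine (hpow.comp (tendsto_add_atTop_nat 1)).frequently (p := fun n : ℕ =>
    (1 - δ) * lilScale ρ n ≤ ∑ i ∈ Finset.range n, X i ω) ?_
  have h3 : ∀ᶠ k : ℕ in atTop, Real.exp 1 ≤ ((q : ℝ) ^ 2) ^ k :=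
    (tendsto_pow_atTop_atTop_of_one_lt (by nlinarith)).eventually_ge_atTop _
  refine (h1.and_eventually ((hpow.eventually h2).and h3)).mono ?_
  rintro k ⟨h4, h5, h6⟩
  simp only [Function.comp_apply]
  rw [← Finset.sum_range_add_sum_Ico _ (Nat.pow_le_pow_right (by positivity) (Nat.le_add_right k 1))]
  rw [Finset.sum_neg_distrib] at h5
  push_cast at h4 h5 ⊢
  have h7 := lilScale_pow_le hρ.le (by omega : 1 ≤ q) h6
  have h8 := lilScale_nonneg ρ (((q : ℝ) ^ 2) ^ (k + 1))
  set φ := lilScale ρ (((q : ℝ) ^ 2) ^ (k + 1))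
  have h9 : 2 / ((q : ℝ) ^ 2) ≤ 2 / q := by
    gcongr
    nlinarith
  have h10 : (2 / (q : ℝ) ^ 2) * φ ≤ 2 / q * φ := by gcongr
  have h11 : 4 / (q : ℝ) * φ ≤ δ * φ := by gcongr
  have e1 : φ / q = 1 / q * φ := by ring
  have e2 : 2 / (q : ℝ) = 2 * (1 / q) := by ring
  have e3 : 4 / (q : ℝ) = 4 * (1 / q) := by ring
  rw [e1] at h7
  rw [e2] at h10
  rw [e3] at h11
  linarith

end IteratedLogarithm

section Bernoulli

variable {K : ℕ} {p : Fin K → ℝ}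

/-! ### Bernoulli measures -/

lemma symbolMeasure_singleton (p : Fin K → ℝ) (i : Fin K) :
    symbolMeasure p {i} = ENNReal.ofReal (p i) := by
  classical
  simp [symbolMeasure, Measure.finsetSum_apply, Set.indicator_apply]

lemma isProbabilityMeasure_symbolMeasure (hp : ∀ i, 0 ≤ p i) (hp1 : ∑ i, p i = 1) :
    IsProbabilityMeasure (symbolMeasure p) := by
  constructor
  simp only [symbolMeasure, Measure.finsetSum_apply, Measure.smul_apply, measure_univ, smul_eq_mul,
    mul_one]
  rw [← ENNReal.ofReal_sum_of_nonneg fun i _ => hp i, hp1, ENNReal.ofReal_one]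

lemma integral_symbolMeasure (hp : ∀ i, 0 ≤ p i) (hp1 : ∑ i, p i = 1) (g : Fin K → ℝ) :
    ∫ s, g s ∂symbolMeasure p = ∑ s, p s * g s := by
  have := isProbabilityMeasure_symbolMeasure hp hp1
  rw [integral_fintype Integrable.of_finite]
  refine Finset.sum_congr rfl fun s _ => ?_
  rw [measureReal_def, symbolMeasure_singleton, ENNReal.toReal_ofReal (hp s), smul_eq_mul]

lemma isProbabilityMeasure_bernoulliMeasure (hp : ∀ i, 0 ≤ p i) (hp1 : ∑ i, p i = 1) :
    IsProbabilityMeasure (bernoulliMeasure p) := by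
  have := isProbabilityMeasure_symbolMeasure hp hp1
  unfold bernoulliMeasure
  infer_instance

lemma iIndepFun_coordinate (hp : ∀ i, 0 ≤ p i) (hp1 : ∑ i, p i = 1) :
    iIndepFun (fun i (x : FullShift K) => x i) (bernoulliMeasure p) := by
  have := isProbabilityMeasure_symbolMeasure hp hp1
  exact iIndepFun_infinitePi (P := fun _ : ℕ => symbolMeasure p) (X := fun _ s => s)
    fun _ => measurable_id

lemma iIndepFun_comp_coordinate (hp : ∀ i, 0 ≤ p i) (hp1 : ∑ i, p i = 1) (f : Fin K → ℝ) :
    iIndepFun (fun i (x : FullShift K) => f (x i)) (bernoulliMeasure p) :=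
  (iIndepFun_coordinate hp hp1).comp (fun _ => f) fun _ => measurable_of_finite f

lemma mgf_comp_coordinate (hp : ∀ i, 0 ≤ p i) (hp1 : ∑ i, p i = 1) (f : Fin K → ℝ) (i : ℕ)
    (t : ℝ) : mgf (fun x : FullShift K => f (x i)) (bernoulliMeasure p) t =
      ∑ s, p s * Real.exp (t * f s) := by
  have := isProbabilityMeasure_symbolMeasure hp hp1
  have hmap : (bernoulliMeasure p).map (fun x => x i) = symbolMeasure p :=
    Measure.infinitePi_map_eval _ i
  rw [← integral_symbolMeasure hp hp1, ← hmap, integral_map (measurable_pi_apply i).aemeasurable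
    (measurable_of_finite _).aestronglyMeasurable]
  rfl

lemma abs_sum_mul_exp_sub_le (hp : ∀ i, 0 ≤ p i) (hp1 : ∑ i, p i = 1) {f : Fin K → ℝ} {ρ B : ℝ}
    (hf : ∑ s, p s * f s = 0) (hf2 : ∑ s, p s * f s ^ 2 = ρ) (hB : ∀ s, |f s| ≤ B) {t : ℝ}
    (ht : |t| * B ≤ 1) :
    |∑ s, p s * Real.exp (t * f s) - (1 + ρ * t ^ 2 / 2)| ≤ (|t| * B) ^ 3 := by
  have e : ∑ s, p s * Real.exp (t * f s) - (1 + ρ * t ^ 2 / 2) =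
      ∑ s, p s * (Real.exp (t * f s) - (1 + t * f s + (t * f s) ^ 2 / 2)) := by
    have e1 : ∀ s, p s * (Real.exp (t * f s) - (1 + t * f s + (t * f s) ^ 2 / 2)) =
        p s * Real.exp (t * f s) - p s - t * (p s * f s) - t ^ 2 / 2 * (p s * f s ^ 2) :=
      fun s => by ring
    simp only [e1, Finset.sum_sub_distrib, ← Finset.mul_sum, hf, hf2, hp1]
    ring
  rw [e]
  calc _ ≤ ∑ s, |p s * (Real.exp (t * f s) - (1 + t * f s + (t * f s) ^ 2 / 2))| :=
        Finset.abs_sum_le_sum_abs _ _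
    _ ≤ ∑ s, p s * (|t| * B) ^ 3 := by
        refine Finset.sum_le_sum fun s _ => ?_
        rw [abs_mul, abs_of_nonneg (hp s)]
        refine mul_le_mul_of_nonneg_left ?_ (hp s)
        have h1 : |t * f s| ≤ |t| * B := by
          rw [abs_mul]
          exact mul_le_mul_of_nonneg_left (hB s) (abs_nonneg t)
        have h2 := Real.exp_bound (h1.trans ht) (n := 3) (by norm_num)
        have e2 : ∑ m ∈ Finset.range 3, (t * f s) ^ m / (m.factorial : ℝ) =
            1 + t * f s + (t * f s) ^ 2 / 2 := by
          simp [Finset.sum_range_succ, Nat.factorial]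
        rw [e2] at h2
        have e3 : ((Nat.succ 3 : ℕ) : ℝ) / ((Nat.factorial 3 : ℕ) * (3 : ℕ)) = 2 / 9 := by
          norm_num [Nat.factorial]
        rw [e3] at h2
        have h3 : |t * f s| ^ 3 ≤ (|t| * B) ^ 3 := by gcongr
        have h4 : 0 ≤ |t * f s| ^ 3 := by positivity
        linarith
    _ = _ := by rw [← Finset.sum_mul, hp1, one_mul]

lemma hasGaussianMGFNearZero_comp_coordinate (hp : ∀ i, 0 ≤ p i) (hp1 : ∑ i, p i = 1)
    {f : Fin K → ℝ} {ρ : ℝ} (hρ : 0 < ρ) (hf : ∑ s, p s * f s = 0)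
    (hf2 : ∑ s, p s * f s ^ 2 = ρ) :
    HasGaussianMGFNearZero (fun i (x : FullShift K) => f (x i)) ρ (bernoulliMeasure p) := by
  intro η hη
  have := isProbabilityMeasure_bernoulliMeasure hp hp1
  obtain ⟨B, hB1, hB⟩ : ∃ B : ℝ, 1 ≤ B ∧ ∀ s, |f s| ≤ B := by
    refine ⟨1 + ∑ s, |f s|, ?_, fun s => ?_⟩
    · linarith [Finset.sum_nonneg fun s (_ : s ∈ Finset.univ) => abs_nonneg (f s)]
    · linarith [Finset.single_le_sum (fun s _ => abs_nonneg (f s)) (Finset.mem_univ s)]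
  have hB0 : 0 < B := by linarith
  refine ⟨min (min 1 (1 / B)) (min (η * ρ / (4 * B ^ 3)) (η / ρ)), by positivity, fun t ht i => ?_⟩
  simp only [le_min_iff] at ht
  obtain ⟨⟨ht1, htB⟩, ht3, ht4⟩ := ht
  refine ⟨?_, ?_⟩
  · refine Integrable.of_bound (C := Real.exp (|t| * B)) (Measurable.aestronglyMeasurable
      (((measurable_of_finite f).comp (measurable_pi_apply i)).const_mul t).exp)
      (ae_of_all _ fun x => ?_)
    rw [Real.norm_of_nonneg (Real.exp_pos _).le, Real.exp_le_exp]
    refine (le_abs_self _).trans ?_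
    rw [abs_mul]
    exact mul_le_mul_of_nonneg_left (hB _) (abs_nonneg t)
  rw [mgf_comp_coordinate hp hp1]
  rw [le_div_iff₀ hB0] at htB
  rw [le_div_iff₀ (by positivity)] at ht3
  rw [le_div_iff₀ hρ] at ht4
  have hM := abs_sum_mul_exp_sub_le hp hp1 hf hf2 hB htB
  set M := ∑ s, p s * Real.exp (t * f s)
  rw [abs_le] at hM
  have hsq : t ^ 2 = |t| ^ 2 := (sq_abs t).symm
  have ht0 := abs_nonneg t
  have hv0 : 0 ≤ ρ * t ^ 2 / 2 := by positivity
  have herr : (|t| * B) ^ 3 ≤ η / 2 * (ρ * t ^ 2 / 2) := by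
    have : 0 ≤ |t| ^ 2 * (η * ρ - |t| * (4 * B ^ 3)) :=
      mul_nonneg (by positivity) (by linarith)
    rw [hsq]
    linarith
  have hv : ρ * t ^ 2 / 2 ≤ η / 2 := by
    rw [hsq]
    nlinarith
  set v := ρ * t ^ 2 / 2
  constructor
  · rcases le_or_gt 1 η with h1 | h1
    · have hM1 : 1 ≤ M := by
        calc 1 = ∑ s, p s * (1 + t * f s) := by
              have e1 : ∀ s, p s * (1 + t * f s) = p s + t * (p s * f s) := fun s => by ring
              simp only [e1, Finset.sum_add_distrib, ← Finset.mul_sum, hf, hp1]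
              ring
          _ ≤ M := by
              refine Finset.sum_le_sum fun s _ => mul_le_mul_of_nonneg_left ?_ (hp s)
              linarith [Real.add_one_le_exp (t * f s)]
      refine le_trans (Real.exp_le_one_iff.2 ?_) hM1
      nlinarith
    · have h2 : |(1 - η) * v| ≤ 1 := by
        rw [abs_of_nonneg (mul_nonneg (by linarith) hv0)]
        nlinarith
      have h3 := Real.norm_exp_sub_one_sub_id_le h2
      rw [Real.norm_eq_abs, Real.norm_eq_abs, sq_abs, abs_le] at h3
      have h4 : ((1 - η) * v) ^ 2 ≤ v * v := by
        rw [← sq]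
        gcongr
        nlinarith
      have h5 : v * v ≤ η / 2 * v := by gcongr
      linarith
  · have := Real.add_one_le_exp ((1 + η) * v)
    nlinarith

/-- The probability of seeing the letters `w i` at the distinct positions `g i`. -/
lemma measureReal_coordinates_comp {ι : Type*} [Fintype ι] (hp : ∀ i, 0 ≤ p i)
    (hp1 : ∑ i, p i = 1) {g : ι → ℕ} (hg : Function.Injective g) (w : ι → Fin K) :
    (bernoulliMeasure p).real {x | ∀ i, x (g i) = w i} = ∏ i, p (w i) := by
  have := isProbabilityMeasure_symbolMeasure hp hp1
  have h1 : {x : FullShift K | ∀ i, x (g i) = w i} = (fun x i => x (g i)) ⁻¹' {w} := by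
    ext x
    simp [funext_iff]
  rw [measureReal_def, h1, ← Measure.map_apply (by fun_prop) (measurableSet_singleton _),
    bernoulliMeasure, Measure.map_infinitePi_infinitePi_of_inj hg,
    Measure.infinitePi_singleton_of_fintype]
  simp only [symbolMeasure_singleton]
  rw [ENNReal.toReal_prod]
  exact Finset.prod_congr rfl fun i _ => ENNReal.toReal_ofReal (hp _)

lemma sum_prod_word (hp1 : ∑ i, p i = 1) (m : ℕ) : ∑ w : Fin m → Fin K, ∏ i, p (w i) = 1 := by
  have := Finset.prod_univ_sum (fun _ : Fin m => (Finset.univ : Finset (Fin K))) (fun _ s => p s)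
  rw [Fintype.piFinset_univ] at this
  rw [← this]
  simp [hp1]

/-- The points whose first `m` letters reappear at time `n`. -/
def returnSet (K m n : ℕ) : Set (FullShift K) := {x | ∀ i < m, x (n + i) = x i}

/-- Points whose initial word has small probability rarely return: at a time `n ≥ m` the word of
length `m` that is seen is independent of the initial one. -/
lemma measureReal_sum_le_inter_returnSet_le (hp : ∀ i, 0 ≤ p i) (hp1 : ∑ i, p i = 1)
    {f : Fin K → ℝ} {h : ℝ} (hf : ∀ s, 0 < p s → p s = Real.exp (f s - h)) {m n : ℕ}
    (hmn : m ≤ n) (a : ℝ) :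
    (bernoulliMeasure p).real
      ({x | ∑ i ∈ Finset.range m, f (x i) ≤ a} ∩ returnSet K m n) ≤ Real.exp (a - h * m) := by
  classical
  have := isProbabilityMeasure_bernoulliMeasure hp hp1
  set W : Finset (Fin m → Fin K) := {w | ∑ i, f (w i) ≤ a} with hW
  let g : Fin m ⊕ Fin m → ℕ := Sum.elim (fun i => i) (fun i => n + i)
  have hg : Function.Injective g := by
    rintro (i | i) (j | j) hij
    · exact congrArg _ (Fin.ext hij)
    · have : (i : ℕ) = n + j := hij
      omega
    · have : n + (i : ℕ) = j := hij
      omega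
    · have : n + (i : ℕ) = n + j := hij
      exact congrArg _ (Fin.ext (by omega))
  have hsub : {x | ∑ i ∈ Finset.range m, f (x i) ≤ a} ∩ returnSet K m n ⊆
      ⋃ w ∈ W, {x | ∀ i, x (g i) = Sum.elim w w i} := by
    rintro x ⟨hx1, hx2⟩
    simp only [Set.mem_iUnion]
    refine ⟨fun i => x i, ?_, ?_⟩
    · rw [hW, Finset.mem_filter]
      refine ⟨Finset.mem_univ _, ?_⟩
      rw [← Finset.sum_range (fun i => f (x i))]
      exact hx1
    · rintro (i | i)
      · rfl
      · exact hx2 i i.2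
  refine (measureReal_mono hsub (measure_ne_top _ _)).trans ((measureReal_biUnion_finset_le _ _).trans ?_)
  calc _ ≤ ∑ w ∈ W, (∏ i, p (w i)) * Real.exp (a - h * m) := by
        refine Finset.sum_le_sum fun w hw => ?_
        rw [measureReal_coordinates_comp hp hp1 hg, Fintype.prod_sum_type]
        simp only [Sum.elim_inl, Sum.elim_inr]
        refine mul_le_mul_of_nonneg_left ?_ (Finset.prod_nonneg fun i _ => hp _)
        calc ∏ i, p (w i) ≤ ∏ i, Real.exp (f (w i) - h) := by
              refine Finset.prod_le_prod (fun i _ => hp _) fun i _ => ?_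
              rcases (hp (w i)).eq_or_lt with h0 | h0
              · rw [← h0]; positivity
              · exact (hf _ h0).le
          _ = Real.exp (∑ i, f (w i) - h * m) := by
              rw [← Real.exp_sum, Finset.sum_sub_distrib]
              simp [mul_comm]
          _ ≤ _ := by
              have := (Finset.mem_filter.1 hw).2
              gcongr
    _ ≤ ∑ w : Fin m → Fin K, (∏ i, p (w i)) * Real.exp (a - h * m) :=
        Finset.sum_le_sum_of_subset_of_nonneg (Finset.subset_univ _) fun w _ _ =>
          mul_nonneg (Finset.prod_nonneg fun i _ => hp _) (Real.exp_pos _).le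
    _ = _ := by rw [← Finset.sum_mul, sum_prod_word hp1, one_mul]

/-- The probability that a word `w` stands at the beginning, but at none of the times
`m, 2 * m, …, J * m`. -/
lemma measureReal_word_no_return (hp : ∀ i, 0 ≤ p i) (hp1 : ∑ i, p i = 1) {m : ℕ}
    (w : Fin m → Fin K) (J : ℕ) :
    (bernoulliMeasure p).real {x | (∀ i : Fin m, x i = w i) ∧
      ∀ j < J, ¬ ∀ i : Fin m, x ((j + 1) * m + i) = w i} =
      (∏ i, p (w i)) * (1 - ∏ i, p (w i)) ^ J := by
  have hP := isProbabilityMeasure_bernoulliMeasure hp hp1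
  let c : ℕ → Set (FullShift K) := fun j => {x | ∀ i : Fin m, x (j * m + i) = w i}
  let s : ℕ → Set (FullShift K) := fun j => if j = 0 then c j else (c j)ᶜ
  -- The events `s j` depend on the disjoint blocks `[j * m, (j + 1) * m)` of coordinates.
  have hcm : ∀ j, MeasurableSet[⨆ i ∈ Set.Ico (j * m) ((j + 1) * m),
      MeasurableSpace.comap (fun x : FullShift K => x i) inferInstance] (c j) := by
    intro j
    have : c j = ⋂ i : Fin m, (fun x : FullShift K => x (j * m + i)) ⁻¹' {w i} := by
      ext x
      simp [c]
    rw [this]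
    refine MeasurableSet.iInter fun i => ?_
    have hi : j * m + i ∈ Set.Ico (j * m) ((j + 1) * m) :=
      ⟨by omega, by rw [Nat.succ_mul]; omega⟩
    have hle := le_iSup₂_of_le (f := fun i (_ : i ∈ Set.Ico (j * m) ((j + 1) * m)) =>
      MeasurableSpace.comap (fun x : FullShift K => x i) inferInstance) _ hi le_rfl
    exact hle _ ⟨{w i}, measurableSet_singleton _, rfl⟩
  have hind : iIndepSet s (bernoulliMeasure p) := by
    refine iIndepSet_of_pairwise_disjoint (iIndepFun_coordinate hp hp1)
      (fun i => measurable_pi_apply i) (F := fun j => Set.Ico (j * m) ((j + 1) * m))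
      (Monotone.pairwise_disjoint_on_Ico_succ (f := fun j => j * m)
        fun a b hab => Nat.mul_le_mul_right m hab) fun j => ?_
    by_cases hj : j = 0
    · simp only [s, hj, if_true]
      exact hj ▸ hcm j
    · simp only [s, hj, if_false]
      exact (hcm j).compl
  have hcm' : ∀ j, MeasurableSet (c j) := fun j =>
    iSup₂_le (fun i _ => (measurable_pi_apply i).comap_le) _ (hcm j)
  have hsm : ∀ j, MeasurableSet (s j) := fun j => by
    by_cases hj : j = 0
    · simp only [s, hj, if_true]
      exact hcm' 0
    · simp only [s, hj, if_false]
      exact (hcm' j).compl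
  have hc : ∀ j, (bernoulliMeasure p).real (c j) = ∏ i, p (w i) := fun j =>
    measureReal_coordinates_comp hp hp1 (g := fun i : Fin m => j * m + i)
      (fun a b hab => Fin.ext (by simpa using hab)) w
  have h1 := (iIndepSet_iff_meas_biInter hsm).1 hind (Finset.range (J + 1))
  have h2 := congrArg ENNReal.toReal h1
  rw [ENNReal.toReal_prod, Finset.prod_range_succ'] at h2
  have e0 : (bernoulliMeasure p (s 0)).toReal = ∏ i, p (w i) := by
    rw [← measureReal_def]; simpa [s] using hc 0
  have e1 : ∀ j, (bernoulliMeasure p (s (j + 1))).toReal = 1 - ∏ i, p (w i) := fun j => by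
    rw [← measureReal_def]
    simp only [s, Nat.succ_ne_zero, if_false]
    rw [probReal_compl_eq_one_sub (hcm' _), hc]
  simp only [e0, e1, Finset.prod_const, Finset.card_range] at h2
  rw [mul_comm, ← h2, measureReal_def]
  congr 2
  ext x
  simp only [Set.mem_ofPred_eq, Set.mem_iInter, Finset.mem_range]
  constructor
  · rintro ⟨h3, h4⟩ j hj
    obtain _ | j := j
    · simpa [s, c] using h3
    · exact h4 j (by omega)
  · intro h3
    refine ⟨by simpa [s, c] using h3 0 (by omega), fun j hj => ?_⟩
    exact h3 (j + 1) (by omega)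

/-- Points whose initial word has large probability return quickly: the chances at the times
`m, 2 * m, …, J * m` are independent. -/
lemma measureReal_le_sum_inter_no_return_le (hp : ∀ i, 0 ≤ p i) (hp1 : ∑ i, p i = 1)
    {f : Fin K → ℝ} {h : ℝ} (hf : ∀ s, 0 < p s → p s = Real.exp (f s - h)) (m J : ℕ) (a : ℝ) :
    (bernoulliMeasure p).real {x | a ≤ ∑ i ∈ Finset.range m, f (x i) ∧
      ∀ j < J, x ∉ returnSet K m ((j + 1) * m)} ≤ Real.exp (-(J * Real.exp (a - h * m))) := by
  classical
  have := isProbabilityMeasure_bernoulliMeasure hp hp1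
  set W : Finset (Fin m → Fin K) := {w | a ≤ ∑ i, f (w i)} with hW
  have hsub : {x | a ≤ ∑ i ∈ Finset.range m, f (x i) ∧
      ∀ j < J, x ∉ returnSet K m ((j + 1) * m)} ⊆
      ⋃ w ∈ W, {x | (∀ i : Fin m, x i = w i) ∧
        ∀ j < J, ¬ ∀ i : Fin m, x ((j + 1) * m + i) = w i} := by
    rintro x ⟨hx1, hx2⟩
    simp only [Set.mem_iUnion]
    refine ⟨fun i => x i, ?_, fun _ => rfl, fun j hj hcon => hx2 j hj fun i hi => hcon ⟨i, hi⟩⟩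
    rw [hW, Finset.mem_filter]
    refine ⟨Finset.mem_univ _, ?_⟩
    rw [← Finset.sum_range (fun i => f (x i))]
    exact hx1
  refine (measureReal_mono hsub (measure_ne_top _ _)).trans ((measureReal_biUnion_finset_le _ _).trans ?_)
  calc _ ≤ ∑ w ∈ W, (∏ i, p (w i)) * Real.exp (-(J * Real.exp (a - h * m))) := by
        refine Finset.sum_le_sum fun w hw => ?_
        rw [measureReal_word_no_return hp hp1]
        rcases (Finset.prod_nonneg fun i (_ : i ∈ Finset.univ) => hp (w i)).eq_or_lt with h0 | h0
        · rw [← h0]; simp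
        refine mul_le_mul_of_nonneg_left ?_ h0.le
        have hpos : ∀ i, 0 < p (w i) := fun i =>
          (hp _).lt_of_ne' (Finset.prod_ne_zero_iff.1 h0.ne' i (Finset.mem_univ i))
        have hprod : ∏ i, p (w i) = Real.exp (∑ i, f (w i) - h * m) := by
          rw [Finset.prod_congr rfl fun i _ => hf _ (hpos i), ← Real.exp_sum,
            Finset.sum_sub_distrib]
          simp [mul_comm]
        have hle1 : ∏ i, p (w i) ≤ 1 := by
          rw [← sum_prod_word hp1 m]
          exact Finset.single_le_sum (f := fun w : Fin m → Fin K => ∏ i, p (w i))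
            (fun w _ => Finset.prod_nonneg fun i _ => hp _) (Finset.mem_univ w)
        calc (1 - ∏ i, p (w i)) ^ J ≤ Real.exp (-∏ i, p (w i)) ^ J := by
              gcongr
              exact Real.one_sub_le_exp_neg _
          _ = Real.exp (-(J * ∏ i, p (w i))) := by
              rw [← Real.exp_nat_mul]; congr 1; ring
          _ ≤ _ := by
              rw [hprod]
              have := (Finset.mem_filter.1 hw).2
              gcongr
    _ ≤ ∑ w : Fin m → Fin K, (∏ i, p (w i)) * Real.exp (-(J * Real.exp (a - h * m))) :=
        Finset.sum_le_sum_of_subset_of_nonneg (Finset.subset_univ _) fun w _ _ =>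
          mul_nonneg (Finset.prod_nonneg fun i _ => hp _) (Real.exp_pos _).le
    _ = _ := by rw [← Finset.sum_mul, sum_prod_word hp1, one_mul]

end Bernoulli

section Asymptotics

variable {h ρ : ℝ}

/-! ### Asymptotics of the return length -/

/-- Taking logarithms turns a comparison up to a constant factor into asymptotic equality; used
twice, this compares iterated logarithms. -/
lemma tendsto_log_div_log {ι : Type*} {l : Filter ι} {u v : ι → ℝ} {κ : ℝ} (hκ : 0 < κ)
    (hv : Tendsto v l atTop) (huv : Tendsto (fun i => u i / v i) l (𝓝 κ)) :
    Tendsto (fun i => Real.log (u i) / Real.log (v i)) l (𝓝 1) := by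
  have hlv := Real.tendsto_log_atTop.comp hv
  have h1 : Tendsto (fun i => Real.log (u i / v i) / Real.log (v i) + 1) l (𝓝 (0 + 1)) :=
    ((huv.log hκ.ne').div_atTop hlv).add_const 1
  rw [zero_add] at h1
  refine h1.congr' ?_
  filter_upwards [hv.eventually_gt_atTop 0, hlv.eventually_gt_atTop 0,
    huv.eventually (eventually_gt_nhds hκ)] with i h2 h3 h4
  simp only [Function.comp_apply] at h3
  have hu : 0 < u i := by
    rwa [div_pos_iff_of_pos_right h2] at h4
  rw [Real.log_div hu.ne' h2.ne']
  field_simp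
  ring

lemma tendsto_lilScale_div_lilScale (hρ : 0 < ρ) {ι : Type*} {l : Filter ι} {u v : ι → ℝ} {κ : ℝ}
    (hκ : 0 < κ) (hv : Tendsto v l atTop) (huv : Tendsto (fun i => u i / v i) l (𝓝 κ)) :
    Tendsto (fun i => lilScale ρ (u i) / lilScale ρ (v i)) l (𝓝 √κ) := by
  have h1 := tendsto_log_div_log one_pos (Real.tendsto_log_atTop.comp hv)
    (tendsto_log_div_log hκ hv huv)
  have h2 := (huv.mul h1).sqrt
  rw [mul_one] at h2
  refine h2.congr' ?_
  filter_upwards [hv.eventually_gt_atTop 0,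
    (tendsto_log_log_atTop.comp hv).eventually_gt_atTop 0] with i h3 h4
  simp only [Function.comp_apply] at h4 ⊢
  rw [lilScale, lilScale, ← Real.sqrt_div' _ (by positivity)]
  congr 1
  field_simp

lemma eventually_mul_log_add_le_lilScale (hρ : 0 < ρ) {κ : ℝ} (hκ : 0 < κ) (C D : ℝ) :
    ∀ᶠ x in atTop, C * Real.log x + D ≤ κ * lilScale ρ x := by
  have h1 : Tendsto (fun x : ℝ => Real.log x / x ^ (1 / 2 : ℝ)) atTop (𝓝 0) :=
    (isLittleO_log_rpow_atTop (by norm_num)).tendsto_div_nhds_zero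
  have h2 : Tendsto (fun x : ℝ => D / x ^ (1 / 2 : ℝ)) atTop (𝓝 0) :=
    tendsto_const_nhds.div_atTop (tendsto_rpow_atTop (by norm_num))
  have h3 := (h1.const_mul C).add h2
  simp only [mul_zero, add_zero] at h3
  filter_upwards [h3.eventually (eventually_le_nhds hκ), eventually_gt_atTop 0,
    tendsto_log_log_atTop.eventually_ge_atTop (1 / (2 * ρ))] with x h4 h5 h6
  rw [← Real.sqrt_eq_rpow, ← mul_div_assoc, ← add_div, div_le_iff₀ (Real.sqrt_pos.2 h5)] at h4
  refine h4.trans (mul_le_mul_of_nonneg_left (Real.sqrt_le_sqrt ?_) hκ.le)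
  rw [div_le_iff₀ (by positivity)] at h6
  nlinarith

/-- The real number whose integer part is `returnLength`, as a function of the logarithm of the
time. -/
noncomputable def returnLengthReal (h ρ c y : ℝ) : ℝ :=
  y / h + c / h ^ (3 / 2 : ℝ) * √(2 * ρ * y * Real.posLog (Real.posLog y))

lemma returnLength_eq_floor (h ρ c : ℝ) (n : ℕ) :
    returnLength h ρ c n = ⌊returnLengthReal h ρ c (Real.posLog n)⌋ := rfl

lemma returnLengthReal_mono (hh : 0 < h) (hρ : 0 < ρ) {c y z : ℝ} (hc : 0 ≤ c) (hy : 0 ≤ y)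
    (hyz : y ≤ z) : returnLengthReal h ρ c y ≤ returnLengthReal h ρ c z := by
  have h1 : Real.posLog y ≤ Real.posLog z := Real.posLog_le_posLog hy hyz
  have h2 : Real.posLog (Real.posLog y) ≤ Real.posLog (Real.posLog z) :=
    Real.posLog_le_posLog Real.posLog_nonneg h1
  have h3 : 0 ≤ Real.posLog (Real.posLog y) := Real.posLog_nonneg
  have h4 : 0 ≤ 2 * ρ * z := by have := hy.trans hyz; positivity
  unfold returnLengthReal
  gcongr

lemma returnLength_le_returnLength (hh : 0 < h) {c d : ℝ} (hcd : c ≤ d) (n : ℕ) :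
    returnLength h ρ c n ≤ returnLength h ρ d n := by
  unfold returnLength
  gcongr

lemma returnLengthReal_eq (hh : 0 < h) (c : ℝ) {y : ℝ} (hy : Real.exp 1 ≤ y) :
    returnLengthReal h ρ c y = (y + c / √h * lilScale ρ y) / h := by
  have h1 := one_le_log_of_exp_one_le hy
  have e1 : Real.posLog y = Real.log y := max_eq_right (by linarith)
  have e2 : Real.posLog (Real.log y) = Real.log (Real.log y) := max_eq_right (Real.log_nonneg h1)
  have e3 : h ^ (3 / 2 : ℝ) = h * √h := by
    rw [Real.sqrt_eq_rpow, show (3 / 2 : ℝ) = 1 + 1 / 2 by norm_num, Real.rpow_add hh,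
      Real.rpow_one]
  rw [returnLengthReal, e1, e2, e3, lilScale]
  have := Real.sqrt_pos.2 hh
  field_simp

lemma posLog_natCast (n : ℕ) : Real.posLog n = Real.log n :=
  max_eq_right (Real.log_natCast_nonneg n)

lemma tendsto_log_natCast : Tendsto (fun n : ℕ => Real.log n) atTop atTop :=
  Real.tendsto_log_atTop.comp tendsto_natCast_atTop_atTop

lemma tendsto_returnLengthReal_div (hh : 0 < h) (c : ℝ) :
    Tendsto (fun y => returnLengthReal h ρ c y / y) atTop (𝓝 (1 / h)) := by
  have h1 : Tendsto (fun y => (1 + c / √h * (lilScale ρ y / y)) / h) atTop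
      (𝓝 ((1 + c / √h * 0) / h)) :=
    (((tendsto_lilScale_div_atTop ρ).const_mul _).const_add 1).div_const h
  rw [mul_zero, add_zero] at h1
  refine h1.congr' ?_
  filter_upwards [eventually_ge_atTop (Real.exp 1)] with y hy
  have hy0 : 0 < y := (Real.exp_pos 1).trans_le hy
  have := Real.sqrt_pos.2 hh
  rw [returnLengthReal_eq hh c hy]
  field_simp

lemma tendsto_toNat_returnLength_div (hh : 0 < h) (c : ℝ) :
    Tendsto (fun n : ℕ => ((returnLength h ρ c n).toNat : ℝ) / Real.log n) atTop
      (𝓝 (1 / h)) := by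
  have h1 := (tendsto_returnLengthReal_div (ρ := ρ) hh c).comp tendsto_log_natCast
  have h2 : Tendsto (fun n : ℕ => returnLengthReal h ρ c (Real.log n)) atTop atTop := by
    refine (h1.pos_mul_atTop (by positivity) tendsto_log_natCast).congr' ?_
    filter_upwards [tendsto_log_natCast.eventually_gt_atTop 0] with n hn
    simp only [Function.comp_apply]
    field_simp
  have h3 := ((tendsto_nat_floor_div_atTop (R := ℝ)).comp h2).mul h1
  rw [one_mul] at h3
  refine h3.congr' ?_
  filter_upwards [h2.eventually_gt_atTop 0] with n hn
  simp only [Function.comp_apply]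
  rw [returnLength_eq_floor, posLog_natCast, Int.floor_toNat]
  field_simp

lemma tendsto_toNat_returnLength (hh : 0 < h) (c : ℝ) :
    Tendsto (fun n : ℕ => (returnLength h ρ c n).toNat) atTop atTop := by
  rw [← tendsto_natCast_atTop_iff (R := ℝ)]
  refine ((tendsto_toNat_returnLength_div (ρ := ρ) hh c).pos_mul_atTop (by positivity)
    tendsto_log_natCast).congr' ?_
  filter_upwards [tendsto_log_natCast.eventually_gt_atTop 0] with n hn
  field_simp

lemma eventually_toNat_returnLength_le (hh : 0 < h) (c : ℝ) :
    ∀ᶠ n : ℕ in atTop, (returnLength h ρ c n).toNat ≤ n := by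
  have h1 : Tendsto (fun n : ℕ => Real.log n / n) atTop (𝓝 0) :=
    Real.isLittleO_log_id_atTop.tendsto_div_nhds_zero.comp tendsto_natCast_atTop_atTop
  have h2 := (tendsto_toNat_returnLength_div (ρ := ρ) hh c).mul h1
  rw [mul_zero] at h2
  filter_upwards [h2.eventually (eventually_le_nhds one_pos), eventually_gt_atTop 0,
    tendsto_log_natCast.eventually_gt_atTop 0] with n h3 h4 h5
  rw [div_mul_div_cancel₀ h5.ne', div_le_one (by exact_mod_cast h4)] at h3
  exact_mod_cast h3

/-- If the initial word of length `m = returnLength h ρ (1 + ε) n` obeys the upper half of the law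
of the iterated logarithm, its probability is at most `1 / (n * (log n) ^ 2)`. -/
lemma eventually_lilScale_sub_le (hh : 0 < h) (hρ : 0 < ρ) {δ ε : ℝ} (hδε : δ < ε) :
    ∀ᶠ n : ℕ in atTop, (1 + δ) * lilScale ρ (returnLength h ρ (1 + ε) n).toNat -
      h * (returnLength h ρ (1 + ε) n).toNat ≤ -(Real.log n + 2 * Real.log (Real.log n)) := by
  have hs := Real.sqrt_pos.2 hh
  have h1 := tendsto_lilScale_div_lilScale hρ (by positivity) tendsto_log_natCast
    (tendsto_toNat_returnLength_div (ρ := ρ) hh (1 + ε))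
  have h2 := (h1.const_mul (1 + δ)).const_sub ((1 + ε) / √h)
  have e : (1 + ε) / √h - (1 + δ) * √(1 / h) = (ε - δ) / √h := by
    rw [Real.sqrt_div zero_le_one, Real.sqrt_one]
    ring
  rw [e] at h2
  have hpos : 0 < (ε - δ) / √h := div_pos (by linarith) hs
  filter_upwards [h2.eventually (eventually_ge_nhds (half_lt_self hpos)),
    tendsto_log_natCast.eventually_gt_atTop (Real.exp 1),
    tendsto_log_natCast.eventually
      (eventually_mul_log_add_le_lilScale hρ (half_pos hpos) 2 h)] with n h3 h4 h5
  have hl0 : 0 < Real.log n := (Real.exp_pos 1).trans h4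
  have hL : 0 < Real.log (Real.log (Real.log n)) :=
    Real.log_pos (by rwa [Real.lt_log_iff_exp_lt hl0])
  have hg : 0 < lilScale ρ (Real.log n) := Real.sqrt_pos.2 (by positivity)
  have h6 := mul_le_mul_of_nonneg_right h3 hg.le
  rw [sub_mul, mul_assoc, div_mul_cancel₀ _ hg.ne'] at h6
  have h7 : returnLengthReal h ρ (1 + ε) (Real.log n) - 1 <
      ((returnLength h ρ (1 + ε) n).toNat : ℝ) := by
    rw [returnLength_eq_floor, posLog_natCast, Int.floor_toNat]
    exact Nat.sub_one_lt_floor _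
  rw [returnLengthReal_eq hh _ h4.le, sub_lt_iff_lt_add, div_lt_iff₀ hh] at h7
  linarith

lemma tendsto_mul_sub_lilScale_div (h : ℝ) (ρ c : ℝ) :
    Tendsto (fun x => (h * x - c * lilScale ρ x) / x) atTop (𝓝 h) := by
  have h1 := ((tendsto_lilScale_div_atTop ρ).const_mul c).const_sub h
  rw [mul_zero, sub_zero] at h1
  refine h1.congr' ?_
  filter_upwards [eventually_gt_atTop 0] with x hx
  field_simp

/-- Up to time `exp (h m - c φ(m))`, with `φ` the scale of the law of the iterated logarithm, a
return of length `m` is long enough for the constant `d < c`. -/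
lemma eventually_forall_returnLength_le (hh : 0 < h) (hρ : 0 < ρ) {c d : ℝ} (hd : 0 ≤ d)
    (hdc : d < c) : ∀ᶠ m : ℕ in atTop, ∀ n : ℕ, 0 < n →
      (n : ℝ) ≤ Real.exp (h * m - c * lilScale ρ m) → returnLength h ρ d n ≤ m := by
  have hs := Real.sqrt_pos.2 hh
  have h1 := (tendsto_mul_sub_lilScale_div h ρ c).comp
    (tendsto_natCast_atTop_atTop (R := ℝ))
  have h2 : Tendsto (fun m : ℕ => h * (m : ℝ) - c * lilScale ρ m) atTop atTop := by
    refine (h1.pos_mul_atTop hh tendsto_natCast_atTop_atTop).congr' ?_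
    filter_upwards [eventually_gt_atTop 0] with m hm
    have : (m : ℝ) ≠ 0 := by positivity
    simp only [Function.comp_apply]
    field_simp
  have h3 := (tendsto_lilScale_div_lilScale hρ hh tendsto_natCast_atTop_atTop h1).const_mul
    (d / √h)
  rw [div_mul_cancel₀ _ hs.ne'] at h3
  filter_upwards [h2.eventually_ge_atTop (Real.exp 1), h3.eventually (eventually_le_nhds hdc),
    tendsto_natCast_atTop_atTop.eventually_gt_atTop (Real.exp 1)] with m h4 h5 h6 n hn hnm
  have hm0 : (0 : ℝ) < m := (Real.exp_pos 1).trans h6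
  have hL : 0 < Real.log (Real.log m) := Real.log_pos (by rwa [Real.lt_log_iff_exp_lt hm0])
  have hg : 0 < lilScale ρ m := Real.sqrt_pos.2 (by positivity)
  have h7 := mul_le_mul_of_nonneg_right h5 hg.le
  rw [mul_assoc, div_mul_cancel₀ _ hg.ne'] at h7
  have hlog : Real.log n ≤ h * m - c * lilScale ρ m := by
    rwa [Real.log_le_iff_le_exp (by exact_mod_cast hn)]
  rw [returnLength_eq_floor, posLog_natCast]
  have h8 := (returnLengthReal_mono hh hρ hd (Real.log_natCast_nonneg n) hlog).trans_eq
    (returnLengthReal_eq hh d h4)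
  have h9 : returnLengthReal h ρ d (Real.log n) ≤ (m : ℤ) := by
    refine h8.trans ?_
    rw [div_le_iff₀ hh]
    push_cast
    linarith
  exact Int.cast_le.1 ((Int.floor_le _).trans h9)

/-- The number of tests at the multiples of `m` up to time `exp (h m - c φ(m))`, times the
probability `exp (b φ(m) - h m)` of success, is at least `m`. -/
lemma eventually_le_floor_mul_exp (hh : 0 < h) (hρ : 0 < ρ) {b c : ℝ} (hcb : c < b) :
    ∀ᶠ m : ℕ in atTop, (m : ℝ) ≤ ⌊Real.exp (h * m - c * lilScale ρ m) / m⌋₊ *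
      Real.exp (b * lilScale ρ m - h * m) := by
  have h1 := (tendsto_mul_sub_lilScale_div h ρ b).comp
    (tendsto_natCast_atTop_atTop (R := ℝ))
  filter_upwards [h1.eventually (eventually_ge_nhds hh), eventually_ge_atTop 2,
    tendsto_natCast_atTop_atTop.eventually
      (eventually_mul_log_add_le_lilScale hρ (sub_pos.2 hcb) 3 0)] with m h2 h3 h4
  have hm2 : (2 : ℝ) ≤ m := by exact_mod_cast h3
  have hm0 : (0 : ℝ) < m := by linarith
  have h5 : Real.exp (b * lilScale ρ m - h * m) ≤ 1 := by
    rw [Real.exp_le_one_iff]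
    simp only [Function.comp_apply] at h2
    rw [le_div_iff₀ hm0] at h2
    linarith
  have h6 : (m : ℝ) ^ 3 ≤ Real.exp (h * m - c * lilScale ρ m) *
      Real.exp (b * lilScale ρ m - h * m) := by
    rw [← Real.exp_add, ← Real.log_le_iff_le_exp (by positivity), Real.log_pow]
    push_cast
    linarith
  have h7 := (Nat.sub_one_lt_floor (Real.exp (h * m - c * lilScale ρ m) / m)).le
  calc (m : ℝ) ≤ (m : ℝ) ^ 3 / m - 1 := by
        have : (m : ℝ) ^ 3 / m = m * m := by field_simp
        rw [this]
        nlinarith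
    _ ≤ Real.exp (h * m - c * lilScale ρ m) * Real.exp (b * lilScale ρ m - h * m) / m -
        Real.exp (b * lilScale ρ m - h * m) := by gcongr
    _ = (Real.exp (h * m - c * lilScale ρ m) / m - 1) *
        Real.exp (b * lilScale ρ m - h * m) := by ring
    _ ≤ _ := by gcongr

/-- `∑ 1 / (n (log n)²)` converges, by Cauchy condensation. -/
lemma summable_exp_neg_log_add_log_log :
    Summable fun n : ℕ => Real.exp (-(Real.log n + 2 * Real.log (Real.log n))) := by
  rw [← summable_condensed_iff_of_eventually_nonneg
    (Eventually.of_forall fun n => (Real.exp_pos _).le)]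
  · have h1 : Summable fun k : ℕ => (Real.log 2 ^ 2)⁻¹ * ((k : ℝ) ^ 2)⁻¹ :=
      (Real.summable_nat_pow_inv.2 one_lt_two).mul_left _
    refine (summable_congr_atTop ?_).2 h1
    filter_upwards [eventually_gt_atTop 0] with k hk
    have hk0 : (0 : ℝ) < k := by exact_mod_cast hk
    have h2 : 0 < k * Real.log 2 := mul_pos hk0 (Real.log_pos one_lt_two)
    push_cast
    rw [neg_add, Real.exp_add, Real.exp_neg, Real.exp_log (by positivity), Real.log_pow,
      Real.exp_neg, two_mul, Real.exp_add, Real.exp_log h2]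
    field_simp
  · filter_upwards [tendsto_natCast_atTop_atTop.eventually_ge_atTop (Real.exp 1)] with k hk
    have h1 : (k : ℝ) ≤ ((k + 1 : ℕ) : ℝ) := by push_cast; linarith
    have h2 := log_log_le_log_log hk h1
    have h3 : 0 < (k : ℝ) := (Real.exp_pos 1).trans_le hk
    gcongr

end Asymptotics

section Recurrence

variable {K : ℕ} {p : Fin K → ℝ}

/-! ### Entropy and variance -/

lemma variance_eq_sum (hp1 : ∑ i, p i = 1) :
    variance p = ∑ i, p i * (entropy p + Real.log (p i)) ^ 2 := by
  have e : ∀ i, p i * (entropy p + Real.log (p i)) ^ 2 =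
      entropy p ^ 2 * p i + 2 * entropy p * (p i * Real.log (p i)) + p i * Real.log (p i) ^ 2 :=
    fun i => by ring
  simp only [e, Finset.sum_add_distrib, ← Finset.mul_sum, hp1]
  rw [variance, entropy]
  ring

lemma sum_mul_entropy_add_log (hp1 : ∑ i, p i = 1) :
    ∑ i, p i * (entropy p + Real.log (p i)) = 0 := by
  simp only [mul_add, Finset.sum_add_distrib, ← Finset.sum_mul, hp1]
  rw [entropy]
  ring

lemma entropy_pos (hp : ∀ i, 0 ≤ p i) (hp1 : ∑ i, p i = 1) {i j : Fin K} (hi : 0 < p i)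
    (hj : 0 < p j) (hij : i ≠ j) : 0 < entropy p := by
  have hle : ∀ s, p s ≤ 1 := fun s =>
    hp1 ▸ Finset.single_le_sum (fun s _ => hp s) (Finset.mem_univ s)
  have hlt : p i < 1 := by
    have h1 : ∑ s ∈ {i, j}, p s ≤ ∑ s, p s :=
      Finset.sum_le_sum_of_subset_of_nonneg (Finset.subset_univ _) fun s _ _ => hp s
    rw [Finset.sum_pair hij, hp1] at h1
    linarith
  rw [entropy, ← Finset.sum_neg_distrib]
  refine Finset.sum_pos' (fun s _ => ?_) ⟨i, Finset.mem_univ i, ?_⟩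
  · have := mul_nonpos_of_nonneg_of_nonpos (hp s) (Real.log_nonpos (hp s) (hle s))
    linarith
  · have := mul_neg_of_pos_of_neg hi (Real.log_neg hi hlt)
    linarith

lemma variance_pos (hp : ∀ i, 0 ≤ p i) (hp1 : ∑ i, p i = 1) {i j : Fin K} (hi : 0 < p i)
    (hj : 0 < p j) (hij : p i ≠ p j) : 0 < variance p := by
  rw [variance_eq_sum hp1]
  have hnn : ∀ s, 0 ≤ p s * (entropy p + Real.log (p s)) ^ 2 := fun s =>
    mul_nonneg (hp s) (sq_nonneg _)
  refine (Finset.sum_nonneg fun s _ => hnn s).lt_of_ne' fun h0 => hij ?_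
  have hz : ∀ s, 0 < p s → Real.log (p s) = -entropy p := by
    intro s hs
    have h1 := (Finset.sum_eq_zero_iff_of_nonneg fun s _ => hnn s).1 h0 s (Finset.mem_univ s)
    have h2 := pow_eq_zero_iff two_ne_zero |>.1 ((mul_eq_zero.1 h1).resolve_left hs.ne')
    linarith
  exact Real.log_injOn_pos hi hj ((hz i hi).trans (hz j hj).symm)

/-! ### Recurrence -/

lemma leftShift_iterate_apply (n : ℕ) (x : FullShift K) (i : ℕ) :
    leftShift^[n] x i = x (n + i) := by
  induction n generalizing x with
  | zero => simp
  | succ n ih =>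
    rw [Function.iterate_succ_apply, ih]
    exact congrArg x (by omega)

/-- Both sides hold for `z < 0`, where `z.toNat = 0`, and for every `z` if `x` has period `n`. -/
lemma shiftDist_leftShift_le_iff (hK : 2 ≤ K) (n : ℕ) (x : FullShift K) (z : ℤ) :
    shiftDist (leftShift^[n] x) x ≤ (K : ℝ) ^ (-z) ↔ x ∈ returnSet K z.toNat n := by
  have hK1 : (1 : ℝ) < K := by exact_mod_cast hK
  have hmem : x ∈ returnSet K z.toNat n ↔
      leftShift^[n] x ∈ PiNat.cylinder (E := fun _ => Fin K) x z.toNat := by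
    rw [PiNat.mem_cylinder_iff]
    simp only [leftShift_iterate_apply]
    rfl
  rw [hmem]
  by_cases hx : leftShift^[n] x = x
  · rw [hx]
    have : (0 : ℝ) ≤ (K : ℝ) ^ (-z) := by positivity
    simpa [shiftDist] using this
  · rw [shiftDist, if_neg hx, zpow_le_zpow_iff_right₀ hK1,
      PiNat.mem_cylinder_iff_le_firstDiff hx]
    omega

lemma mem_recurrenceSet_iff (hK : 2 ≤ K) (h ρ c : ℝ) (x : FullShift K) :
    x ∈ recurrenceSet shiftDist leftShift (returnRate K h ρ c) ↔
      ∃ᶠ n : ℕ in atTop, x ∈ returnSet K (returnLength h ρ c n).toNat n := by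
  simp only [← shiftDist_leftShift_le_iff hK]
  rfl

lemma returnSet_subset {m l : ℕ} (hml : m ≤ l) (n : ℕ) : returnSet K l n ⊆ returnSet K m n :=
  fun _ hx i hi => hx i (hi.trans_le hml)

/-- Returns of the length belonging to the constant `1 + ε` stop: by the upper half of the law of
the iterated logarithm, the initial words in question eventually have probability at most
`1 / (n (log n)²)`, which is summable. -/
theorem ae_notMem_recurrenceSet (hK : 2 ≤ K) (hp : ∀ i, 0 ≤ p i) (hp1 : ∑ i, p i = 1)
    (hh : 0 < entropy p) (hρ : 0 < variance p) {ε : ℝ} (hε : 0 < ε) :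
    ∀ᵐ x ∂bernoulliMeasure p,
      x ∉ recurrenceSet shiftDist leftShift (returnRate K (entropy p) (variance p) (1 + ε)) := by
  have hP := isProbabilityMeasure_bernoulliMeasure hp hp1
  set f : Fin K → ℝ := fun s => entropy p + Real.log (p s) with hf
  have hexp : ∀ s, 0 < p s → p s = Real.exp (f s - entropy p) := fun s hs => by
    simp [hf, Real.exp_log hs]
  set m : ℕ → ℕ := fun n => (returnLength (entropy p) (variance p) (1 + ε) n).toNat with hm
  have hlil := ae_eventually_sum_le
    (hasGaussianMGFNearZero_comp_coordinate hp hp1 hρ (sum_mul_entropy_add_log hp1)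
      (variance_eq_sum hp1).symm)
    (iIndepFun_comp_coordinate hp hp1 f)
    (fun i => (measurable_of_finite f).comp (measurable_pi_apply i)) hρ (half_pos hε)
  have hbc := ae_eventually_notMem_of_summable (μ := bernoulliMeasure p)
    (s := fun n => {x | ∑ i ∈ Finset.range (m n), f (x i) ≤
      (1 + ε / 2) * lilScale (variance p) (m n)} ∩ returnSet K (m n) n)
    summable_exp_neg_log_add_log_log (by
      filter_upwards [eventually_toNat_returnLength_le (ρ := variance p) hh (1 + ε),
        eventually_lilScale_sub_le hh hρ (half_lt_self hε)] with n h1 h2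
      exact (measureReal_sum_le_inter_returnSet_le hp hp1 hexp h1 _).trans
        (Real.exp_le_exp.2 h2))
  filter_upwards [hlil, hbc] with x h1 h2
  rw [mem_recurrenceSet_iff hK, not_frequently]
  filter_upwards [(tendsto_toNat_returnLength (ρ := variance p) hh (1 + ε)).eventually h1, h2]
    with n h3 h4 h5
  exact h4 ⟨h3, h5⟩

/-- Returns of the length belonging to the constant `1 - ε` go on forever: by the lower half of the
law of the iterated logarithm, infinitely many initial words are so probable that they must reappear
early. -/
theorem ae_mem_recurrenceSet (hK : 2 ≤ K) (hp : ∀ i, 0 ≤ p i) (hp1 : ∑ i, p i = 1)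
    (hh : 0 < entropy p) (hρ : 0 < variance p) {ε : ℝ} (hε : 0 < ε) :
    ∀ᵐ x ∂bernoulliMeasure p,
      x ∈ recurrenceSet shiftDist leftShift (returnRate K (entropy p) (variance p) (1 - ε)) := by
  have hP := isProbabilityMeasure_bernoulliMeasure hp hp1
  set f : Fin K → ℝ := fun s => entropy p + Real.log (p s) with hf
  have hexp : ∀ s, 0 < p s → p s = Real.exp (f s - entropy p) := fun s hs => by
    simp [hf, Real.exp_log hs]
  -- Passing from `1 - ε` to `d` asks for longer returns, and `d ≥ 0` makes the return length
  -- monotone in time.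
  set d : ℝ := max (1 - ε) 0 with hd
  have hd0 : 0 ≤ d := le_max_right _ _
  have hd1 : d < 1 := max_lt (by linarith) one_pos
  obtain ⟨c, hdc, hc1⟩ := exists_between hd1
  obtain ⟨b, hcb, hb1⟩ := exists_between hc1
  set J : ℕ → ℕ := fun m =>
    ⌊Real.exp (entropy p * m - c * lilScale (variance p) m) / m⌋₊ with hJ
  have hlil := ae_frequently_le_sum
    (hasGaussianMGFNearZero_comp_coordinate hp hp1 hρ (sum_mul_entropy_add_log hp1)
      (variance_eq_sum hp1).symm)
    (iIndepFun_comp_coordinate hp hp1 f)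
    (fun i => (measurable_of_finite f).comp (measurable_pi_apply i)) hρ (sub_pos.2 hb1)
  have hbc := ae_eventually_notMem_of_summable (μ := bernoulliMeasure p)
    (s := fun m => {x | b * lilScale (variance p) m ≤ ∑ i ∈ Finset.range m, f (x i) ∧
      ∀ j < J m, x ∉ returnSet K m ((j + 1) * m)})
    Real.summable_exp_neg_nat (by
      filter_upwards [eventually_le_floor_mul_exp hh hρ hcb] with m h1
      refine (measureReal_le_sum_inter_no_return_le hp hp1 hexp m (J m) _).trans
        (Real.exp_le_exp.2 ?_)
      linarith)
  filter_upwards [hlil, hbc] with x h1 h2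
  rw [mem_recurrenceSet_iff hK, frequently_atTop]
  intro N
  obtain ⟨m, h3, h4, h5, h6⟩ := (h1.and_eventually
    (h2.and ((eventually_forall_returnLength_le hh hρ hd0 hdc).and
      (eventually_ge_atTop (N + 1))))).exists
  rw [sub_sub_cancel] at h3
  have h7 : ∃ j < J m, x ∈ returnSet K m ((j + 1) * m) := by
    by_contra! hcon
    exact h4 ⟨h3, hcon⟩
  obtain ⟨j, hj, hx⟩ := h7
  have hm0 : 0 < m := by omega
  have hm0' : (0 : ℝ) < m := by exact_mod_cast hm0
  have hle : m ≤ (j + 1) * m := Nat.le_mul_of_pos_left m (Nat.succ_pos j)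
  refine ⟨(j + 1) * m, by omega, returnSet_subset ?_ _ hx⟩
  have h8 := h5 ((j + 1) * m) (by omega) (by
    have h9 : ((j + 1 : ℕ) : ℝ) ≤ Real.exp (entropy p * m - c * lilScale (variance p) m) / m :=
      (Nat.cast_le.2 (Nat.succ_le_of_lt hj)).trans (Nat.floor_le (by positivity))
    rw [le_div_iff₀ hm0'] at h9
    exact_mod_cast h9)
  have h10 := (returnLength_le_returnLength (ρ := variance p) hh (le_max_left (1 - ε) 0)
    ((j + 1) * m)).trans h8
  omega

end Recurrence

end BernoulliRecurrence

theorem theorem1p3 (K : ℕ) (p : Fin K → ℝ) (hp_nonneg : ∀ i, 0 ≤ p i) (hp_sum : ∑ i, p i = 1)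
    (hp_nonuniform : ∃ i j, 0 < p i ∧ 0 < p j ∧ p i ≠ p j) :
    0 < BernoulliRecurrence.entropy p ∧ 0 < BernoulliRecurrence.variance p ∧
      ∀ ε : ℝ, 0 < ε →
        BernoulliRecurrence.bernoulliMeasure p
            (BernoulliRecurrence.recurrenceSet BernoulliRecurrence.shiftDist
              BernoulliRecurrence.leftShift
              (BernoulliRecurrence.returnRate K (BernoulliRecurrence.entropy p)
                (BernoulliRecurrence.variance p) (1 + ε))) = 0 ∧
        BernoulliRecurrence.bernoulliMeasure p
            (BernoulliRecurrence.recurrenceSet BernoulliRecurrence.shiftDist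
              BernoulliRecurrence.leftShift
              (BernoulliRecurrence.returnRate K (BernoulliRecurrence.entropy p)
                (BernoulliRecurrence.variance p) (1 - ε))) = 1 := by
  obtain ⟨i, j, hi, hj, hij⟩ := hp_nonuniform
  have hne : i ≠ j := fun e => hij (congrArg p e)
  have hK : 2 ≤ K := by
    have := Fin.val_ne_of_ne hne
    omega
  have hh := BernoulliRecurrence.entropy_pos hp_nonneg hp_sum hi hj hne
  have hρ := BernoulliRecurrence.variance_pos hp_nonneg hp_sum hi hj hij
  have hP := BernoulliRecurrence.isProbabilityMeasure_bernoulliMeasure hp_nonneg hp_sum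
  refine ⟨hh, hρ, fun ε hε => ⟨?_, ?_⟩⟩
  · exact measure_eq_zero_iff_ae_notMem.2
      (BernoulliRecurrence.ae_notMem_recurrenceSet hK hp_nonneg hp_sum hh hρ hε)
  · have h1 := BernoulliRecurrence.ae_mem_recurrenceSet hK hp_nonneg hp_sum hh hρ hε
    exact (measure_congr (eventuallyEq_univ.2 h1)).trans measure_univ
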